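/- **Definitions.** For a self-map $g$ of a set $X\subset\mathbb R$ put $\chi_g(x)=\tfrac12$ if $(g(x)-x)(g^2(x)-g(x))\le 0$ and $\chi_g(x)=0$ otherwise. The *over-rotation number* of a non-fixed periodic point $y$ of $g$ of (minimal) period $n$ is $\frac1n\sum_{i=0}^{n-1}\chi_g(g^i(y))$. The *over-rotation interval* $I_f$ of a continuous map $f:[0,1]\to[0,1]$ is the closure of the set of over-rotation numbers of all non-fixed periodic points of $f$. A *pattern* is a cyclic permutation $\pi$ of $\{0,1,\dots,n-1\}$, $n\ge1$. A map $f:[0,1]\to[0,1]$ *exhibits* $\pi$ (has a periodic orbit of pattern $\pi$) if there are points $x_0<\dots<x_{n-1}$ in $[0,1]$ with $f(x_i)=x_{\pi(i)}$ for all $i$. A pattern $\pi$ *forces* a pattern $\theta$ if every continuous $f:[0,1]\to[0,1]$ that exhibits $\pi$ also exhibits $\theta$. For $n\ge 2$ the over-rotation number of $\pi$ is that of any of its points under $\pi$, and $\pi$ is an *over-twist pattern* if it forces no other pattern with the same over-rotation number. A pattern is *unimodal* if there is $m$ such that it is strictly increasing on $\{0,\dots,m\}$ and strictly decreasing on $\{m,\dots,n-1\}$.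 A continuous map $f:[0,1]\to[0,1]$ is *unimodal* if there is $c\in(0,1)$ with $f(c)=1$, $f(1)=0$, $f$ strictly increasing on $[0,c]$ and strictly decreasing on $[c,1]$. For coprime positive integers $p,q$ with $2p\le q$ let $\gamma_{p/q}$ be the cyclic permutation of $\{0,\dots,q-1\}$ given by $$\gamma_{p/q}(j)=\begin{cases} j+p, & 0\le j\le q-2p-1,\\ 2q-2p-1-j, & q-2p\le j\le q-p-1,\\ q-1-j, & q-p\le j\le q-1;\end{cases}$$ that is, the first $q-2p$ points are shifted to the right by $p$, the next $p$ points are flipped to the far right, and the last $p$ points are flipped to the far left. **Lemma 2.1.** Let $\rho=p/q$ with $p,q$ coprime positive integers and $0<\rho\le\frac12$. 1. The pattern $\gamma_\rho$ is a unimodal over-twist pattern of over-rotation number $\rho$, and it is the only one. 2. For every unimodal map $f$: there is $\mu\le\rho$ with $I_f=[\mu,\frac12]$ if and only if $f$ has a periodic orbit of pattern $\gamma_\rho$. -/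

import Mathlib

/-! ## Over-rotation numbers -/

/-- The function `χ` of a self-map `g` of a set `X` of points of the real line (`v` is the inclusion
of `X` into `ℝ`): it equals `1/2` at `x` if `(g x - x) (g (g x) - g x) ≤ 0`, and `0` otherwise. -/
noncomputable def chi {X : Type} (v : X → ℝ) (g : X → X) (x : X) : ℝ :=
  if (v (g x) - v x) * (v (g (g x)) - v (g x)) ≤ 0 then 1 / 2 else 0

/-- The over-rotation number of a periodic point `y` of `f : [0,1] → [0,1]`: the average of `χ`
along the orbit of `y`. -/
noncomputable def overRotationNumber (f : unitInterval → unitInterval) (y : unitInterval) : ℝ :=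
  (∑ i ∈ Finset.range (Function.minimalPeriod f y),
    chi (fun x : unitInterval => (x : ℝ)) f (f^[i] y)) / (Function.minimalPeriod f y : ℝ)

/-- The over-rotation interval `I_f`: the closure of the set of over-rotation numbers of all
non-fixed periodic points of `f`. -/
noncomputable def overRotationInterval (f : unitInterval → unitInterval) : Set ℝ :=
  closure {r : ℝ | ∃ y : unitInterval,
    y ∈ Function.periodicPts f ∧ f y ≠ y ∧ overRotationNumber f y = r}

/-! ## Unimodal maps -/

/-- A unimodal map of `[0,1]`: continuous, with a turning point `c ∈ (0,1)` such that `f c = 1`,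
`f 1 = 0`, and `f` increases on `[0,c]` and decreases on `[c,1]`. -/
def IsUnimodalMap (f : unitInterval → unitInterval) : Prop :=
  Continuous f ∧ ∃ c : unitInterval, 0 < c ∧ c < 1 ∧ f c = 1 ∧ f 1 = 0 ∧
    StrictMonoOn f (Set.Icc 0 c) ∧ StrictAntiOn f (Set.Icc c 1)

/-! ## Patterns -/

/-- A pattern: a cyclic permutation of `n ≥ 1` linearly ordered points `0 < 1 < ⋯ < n - 1`. -/
structure Pattern where
  n : ℕ
  pos : 0 < n
  perm : Equiv.Perm (Fin n)
  cyclic : perm.IsCycleOn Set.univ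

/-- `f` exhibits `π`: it has a cycle `P = {e 0 < ⋯ < e (n - 1)}` on which it is conjugate to `π` by
the increasing bijection `e`. -/
def Exhibits (f : unitInterval → unitInterval) (π : Pattern) : Prop :=
  ∃ e : Fin π.n → unitInterval, StrictMono e ∧ ∀ i, f (e i) = e (π.perm i)

/-- `π` forces `θ`: every continuous interval map that exhibits `π` also exhibits `θ`. -/
def Pattern.Forces (π θ : Pattern) : Prop :=
  ∀ f : unitInterval → unitInterval, Continuous f → Exhibits f π → Exhibits f θ

/-- The over-rotation number of a pattern with at least two points: the average of `χ` over the
whole cycle. It is meaningless for the one-point pattern, i.e. for fixed points. -/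
noncomputable def Pattern.overRotationNumber (π : Pattern) : ℝ :=
  (∑ i : Fin π.n, chi (fun k : Fin π.n => ((k : ℕ) : ℝ)) π.perm i) / (π.n : ℝ)

/-- An over-twist pattern: a pattern (not that of a fixed point, which has no over-rotation number)
that forces no other pattern of the same over-rotation number. -/
def Pattern.IsOverTwist (π : Pattern) : Prop :=
  2 ≤ π.n ∧ ∀ θ : Pattern, 2 ≤ θ.n → θ.overRotationNumber = π.overRotationNumber →
    π.Forces θ → θ = π

/-- A unimodal pattern: the permutation increases up to some point and decreases from there on. -/
def Pattern.IsUnimodal (π : Pattern) : Prop :=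
  ∃ m : Fin π.n, StrictMonoOn π.perm (Set.Iic m) ∧ StrictAntiOn π.perm (Set.Ici m)

/-! ## The pattern `γ_{p/q}` -/

/-- The action of `γ_{p/q}` on the points `0, …, q - 1`: the first `q - 2p` points are shifted to
the right by `p`, the next `p` points are flipped to the far right, and the last `p` points are
flipped to the far left. -/
def gammaFun (p q j : ℕ) : ℕ :=
  if j + 2 * p < q then j + p
  else if j + p < q then 2 * q - 2 * p - 1 - j
  else q - 1 - j

theorem gammaFun_lt {p q j : ℕ} (hj : j < q) : gammaFun p q j < q := by
  unfold gammaFun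
  split_ifs <;> omega

theorem gammaFun_injective {p q : ℕ} (hpq : 2 * p ≤ q) :
    Function.Injective (fun j : Fin q => (⟨gammaFun p q j, gammaFun_lt j.2⟩ : Fin q)) := by
  rintro ⟨i, hi⟩ ⟨j, hj⟩ h
  simp only [Fin.mk.injEq] at h ⊢
  unfold gammaFun at h
  split_ifs at h <;> omega

/-- `γ_{p/q}` as a permutation. -/
noncomputable def gammaPerm (p q : ℕ) (hpq : 2 * p ≤ q) : Equiv.Perm (Fin q) :=
  Equiv.ofBijective (fun j : Fin q => (⟨gammaFun p q j, gammaFun_lt j.2⟩ : Fin q))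
    (Finite.injective_iff_bijective.mp (gammaFun_injective hpq))

theorem gammaPerm_cyclic (p q : ℕ) (hp : 0 < p) (hpq : 2 * p ≤ q) (hcop : p.Coprime q) :
    (gammaPerm p q hpq).IsCycleOn Set.univ := by
  have : NeZero q := ⟨by omega⟩
  let a : ℕ → ℕ := fun k => if k + p < q then k else 2 * q - p - 1 - k
  let h : Fin q → ZMod q := fun k => ((a k : ℕ) : ZMod q)
  have ha : ∀ k < q, a k < q := by
    intro k hk
    simp only [a]
    split_ifs <;> omega
  have hinj : Function.Injective h := by
    rintro ⟨i, hi⟩ ⟨j, hj⟩ hij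
    have h1 := (ZMod.natCast_eq_natCast_iff' _ _ _).mp hij
    rw [Nat.mod_eq_of_lt (ha i hi), Nat.mod_eq_of_lt (ha j hj)] at h1
    simp only [a] at h1
    simp only [Fin.mk.injEq]
    split_ifs at h1 <;> omega
  have hstep : ∀ i, h (gammaPerm p q hpq i) = h i + (p : ZMod q) := by
    rintro ⟨i, hi⟩
    have key : a (gammaFun p q i) = a i + p ∨ a (gammaFun p q i) + q = a i + p := by
      simp only [a, gammaFun]
      split_ifs <;> omega
    change ((a (gammaFun p q i) : ℕ) : ZMod q) = ((a i : ℕ) : ZMod q) + (p : ZMod q)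
    rcases key with h1 | h1
    · rw [h1, Nat.cast_add]
    · have h2 := congrArg (Nat.cast : ℕ → ZMod q) h1
      simpa using h2
  have hpow : ∀ (k : ℕ) (i), h ((gammaPerm p q hpq ^ k) i) = h i + (k : ZMod q) * (p : ZMod q) := by
    intro k i
    induction k with
    | zero => simp
    | succ k ih =>
      rw [pow_succ', Equiv.Perm.mul_apply, hstep, ih]
      push_cast
      ring
  refine ⟨(gammaPerm p q hpq).bijective.bijOn_univ, fun i _ j _ => ?_⟩
  refine ⟨(((h j - h i) * (p : ZMod q)⁻¹).val : ℕ), ?_⟩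
  rw [zpow_natCast]
  apply hinj
  rw [hpow, ZMod.natCast_zmod_val, mul_assoc, mul_comm _ (p : ZMod q),
    ZMod.coe_mul_inv_eq_one p hcop]
  ring

/-- The pattern `γ_{p/q}`, for coprime `p`, `q` with `0 < p/q ≤ 1/2`. -/
noncomputable def gammaPattern (p q : ℕ) (hp : 0 < p) (hpq : 2 * p ≤ q) (hcop : p.Coprime q) :
    Pattern where
  n := q
  pos := by omega
  perm := gammaPerm p q hpq
  cyclic := gammaPerm_cyclic p q hp hpq hcop

/-! Let `a` be a fixed point such that the points of a cycle to its left move right and those to its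
right jump to its left. Then `χ` records the crossings of `a`, and the over-rotation number of the
cycle is the proportion of its points to the right of `a`. Flip `[a,1]` and glue `0` to `1`: each
visit to the right of `a` now completes one turn of a circle, so this proportion is a rotation
number. The circle map so obtained need not be monotone. The rotation number `τ` of a nondecreasing
map below it bounds the over-rotation numbers from below (`translationNumber_le_of_orbit`).

Conversely, let `τ ≤ p/q < 1/2`. Truncate the values near `0` at a level `t`, and take the largest
`t` for which the `q`-th iterate of the circle map still satisfies `G^q x ≤ x + p` at some `x`.
There equality holds at `x`, and `G^q z ≥ z + p` everywhere (`exists_semistable`). Such an orbit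
cannot have a flat piece of `G` immediately to its right, so on it `G` comes from `f`
(`lift_eq_apply`). Periodic orbits of monotone circle maps are ordered as those of rotations, and
undoing the flip gives exactly `γ_{p/q}` (`IsFold.exists_gamma`). The value `1/2` needs only a
2-cycle (`exists_two_cycle`).

Hence a unimodal pattern of number `p/q` forces `γ_{p/q}`, and a unimodal map exhibits `γ_{p/q}`
exactly when `τ ≤ p/q`, in which case its over-rotation interval is `[τ, 1/2]`. That `γ_{p/q}` is an
over-twist is seen on one map, `twistMap`: on a circle of length `q` it advances every point by at
least `p`. A cycle of number `p/q` advances by `p` on average, hence by exactly `p` at each step,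
and must have the pattern `γ_{p/q}`. -/

/-! ## Increasing lower envelopes -/

/-- For `l ≤ y ≤ r`, the infimum of `h` over `[y, r]`. -/
noncomputable def infAfter (h : ℝ → ℝ) (l r y : ℝ) : ℝ :=
  sInf ((fun s => h (max y s)) '' Set.Icc l r)

theorem continuous_infAfter {h : ℝ → ℝ} (hh : Continuous h) (l r : ℝ) :
    Continuous (infAfter h l r) := by
  unfold infAfter
  refine IsCompact.continuous_sInf (f := fun y s => h (max y s)) isCompact_Icc ?_
  change Continuous (fun p : ℝ × ℝ => h (max p.1 p.2))
  fun_prop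

theorem exists_infAfter_eq {h : ℝ → ℝ} (hh : Continuous h) {l r y : ℝ} (hl : l ≤ y) (hr : y ≤ r) :
    ∃ s ∈ Set.Icc y r, infAfter h l r y = h s ∧ ∀ u ∈ Set.Icc y r, h s ≤ h u := by
  obtain ⟨s, hs, h1, h2⟩ := isCompact_Icc.exists_sInf_image_eq_and_le
    (⟨y, hl, hr⟩ : (Set.Icc l r).Nonempty) (f := fun s => h (max y s)) (by fun_prop)
  refine ⟨max y s, ⟨le_max_left _ _, max_le hr hs.2⟩, h1, fun u hu => ?_⟩
  have := h2 u ⟨hl.trans hu.1, hu.2⟩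
  simpa [max_eq_right hu.1] using this

theorem infAfter_le {h : ℝ → ℝ} (hh : Continuous h) {l r y u : ℝ} (hl : l ≤ y) (hu : y ≤ u)
    (hr : u ≤ r) : infAfter h l r y ≤ h u := by
  obtain ⟨s, _, h1, h2⟩ := exists_infAfter_eq hh hl (hu.trans hr)
  exact h1.trans_le (h2 u ⟨hu, hr⟩)

theorem infAfter_mono {h : ℝ → ℝ} (hh : Continuous h) {l r y z : ℝ} (hl : l ≤ y) (hyz : y ≤ z)
    (hr : z ≤ r) : infAfter h l r y ≤ infAfter h l r z := by
  obtain ⟨s, hs, h1, -⟩ := exists_infAfter_eq hh (hl.trans hyz) hr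
  exact h1 ▸ infAfter_le hh hl (hyz.trans hs.1) hs.2

/-- The largest nondecreasing function below `h` on `[l, r]`, with its values truncated to
`[lo, hi]`, extended by constants outside `[l, r]`. -/
noncomputable def envelope (h : ℝ → ℝ) (l r lo hi y : ℝ) : ℝ :=
  max lo (min hi (infAfter h l r (max l (min r y))))

section Envelope

variable {h : ℝ → ℝ} {l r lo hi : ℝ}

theorem continuous_envelope (hh : Continuous h) {X : Type*} [TopologicalSpace X] (l r : ℝ)
    {lo hi y : X → ℝ} (hlo : Continuous lo) (hhi : Continuous hi) (hy : Continuous y) :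
    Continuous (fun x => envelope h l r (lo x) (hi x) (y x)) := by
  have := continuous_infAfter hh l r
  unfold envelope
  fun_prop

theorem envelope_mono (hh : Continuous h) (hlr : l ≤ r) :
    Monotone (envelope h l r lo hi) := by
  intro y z hyz
  unfold envelope
  have : infAfter h l r (max l (min r y)) ≤ infAfter h l r (max l (min r z)) :=
    infAfter_mono hh (le_max_left _ _) (by gcongr) (max_le hlr (min_le_left _ _))
  gcongr

theorem le_envelope (y : ℝ) : lo ≤ envelope h l r lo hi y := le_max_left _ _

theorem envelope_le (hlh : lo ≤ hi) (y : ℝ) : envelope h l r lo hi y ≤ hi :=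
  max_le hlh (min_le_left _ _)

theorem envelope_eq_lo (hlr : l ≤ r) (hl : infAfter h l r l ≤ lo) {y : ℝ} (hy : y ≤ l) :
    envelope h l r lo hi y = lo := by
  unfold envelope
  rw [min_eq_right (hy.trans hlr), max_eq_left hy]
  exact max_eq_left ((min_le_right _ _).trans hl)

theorem envelope_eq_hi (hh : Continuous h) (hlr : l ≤ r) (hlh : lo ≤ hi) (hr : hi ≤ h r) {y : ℝ}
    (hy : r ≤ y) : envelope h l r lo hi y = hi := by
  unfold envelope
  rw [min_eq_left hy, max_eq_right hlr]
  obtain ⟨s, hs, h1, -⟩ := exists_infAfter_eq hh hlr le_rfl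
  have : s = r := le_antisymm hs.2 hs.1
  rw [h1, this, min_eq_left hr, max_eq_right hlh]

theorem envelope_le_apply (hh : Continuous h) {y : ℝ} (hl : l ≤ y) (hr : y ≤ r) (hlo : lo ≤ h y) :
    envelope h l r lo hi y ≤ h y := by
  unfold envelope
  rw [min_eq_right hr, max_eq_right hl]
  exact max_le hlo ((min_le_right _ _).trans (infAfter_le hh hl le_rfl hr))

/-- Where the envelope increases to the right, it agrees with the function. -/
theorem envelope_eq_apply (hh : Continuous h) {y : ℝ} (hl : l ≤ y) (hr : y < r)
    (hy : ∀ z, y < z → z ≤ r → envelope h l r lo hi y < envelope h l r lo hi z) :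
    envelope h l r lo hi y = h y ∧ lo ≤ h y ∧ h y < hi := by
  have key : ∀ z, l ≤ z → z ≤ r →
      envelope h l r lo hi z = max lo (min hi (infAfter h l r z)) := by
    intro z h1 h2
    unfold envelope
    rw [min_eq_right h2, max_eq_right h1]
  -- Below `lo` the truncation would keep the envelope equal to `lo` just to the right of `y`.
  have hlow : lo ≤ infAfter h l r y := by
    by_contra! hc
    have hev : ∀ᶠ z in nhdsWithin y (Set.Ioi y), infAfter h l r z < lo :=
      ((continuous_infAfter hh l r).tendsto y).mono_left nhdsWithin_le_nhds
        |>.eventually_lt_const hc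
    have hev2 : ∀ᶠ z in nhdsWithin y (Set.Ioi y), z ∈ Set.Ioc y r := Ioc_mem_nhdsGT hr
    obtain ⟨z, hz, hz2⟩ := (hev.and hev2).exists
    have := hy z hz2.1 hz2.2
    rw [key y hl hr.le, key z (hl.trans hz2.1.le) hz2.2,
      max_eq_left ((min_le_right _ _).trans hc.le), max_eq_left ((min_le_right _ _).trans hz.le)]
      at this
    exact lt_irrefl _ this
  have hhigh : infAfter h l r y < hi := by
    by_contra! hc
    have := hy r hr le_rfl
    have h2 := infAfter_mono hh hl hr.le le_rfl
    rw [key y hl hr.le, key r (hl.trans hr.le) le_rfl, min_eq_left hc, min_eq_left (hc.trans h2)]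
      at this
    exact lt_irrefl _ this
  obtain ⟨s, hs, h1, -⟩ := exists_infAfter_eq hh hl hr.le
  -- A minimum over `[y, r]` attained at some `s > y` would make the envelope constant on `[y, s]`.
  have hsy : s = y := by
    by_contra hne
    have hlt : y < s := lt_of_le_of_ne hs.1 (Ne.symm hne)
    have h2 := hy s hlt hs.2
    rw [key y hl hr.le, key s (hl.trans hs.1) hs.2] at h2
    have h3 : infAfter h l r s ≤ infAfter h l r y := h1 ▸ infAfter_le hh (hl.trans hs.1) le_rfl hs.2
    exact absurd h2 (not_lt.2 (by gcongr))
  rw [hsy] at h1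
  rw [key y hl hr.le, min_eq_right hhigh.le, max_eq_right hlow, ← h1]
  exact ⟨rfl, hlow, hhigh⟩

end Envelope

/-! ## The circle map of a fold -/

/-- A continuous map with a fixed point `a`, that sends some `c < a` to the right of `[0,1]` and
`1` to its left. -/
structure IsFold (f : ℝ → ℝ) (c a : ℝ) : Prop where
  cont : Continuous f
  c_nonneg : 0 ≤ c
  c_lt : c < a
  lt_one : a < 1
  fix : f a = a
  top : 1 ≤ f c
  bot : f 1 ≤ 0

/-- Flip `[a,1]` and identify `0` with `1`. The orbits of `f` which jump across `a` then move
around a circle; this is the largest nondecreasing function below the map so obtained, the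
values of `f` near `0` being truncated at `t`. -/
noncomputable def foldBase (f : ℝ → ℝ) (c a t y : ℝ) : ℝ :=
  envelope f 0 c t a y + envelope (fun y => 1 + a - f y) c a a 1 y
    + envelope (fun y => 1 + f (1 + a - y)) a 1 1 (1 + t) y - a - 1

/-- The least level at which `foldBase` gives a circle map. -/
noncomputable def foldLevel (f : ℝ → ℝ) (c a : ℝ) : ℝ :=
  min a (max 0 (infAfter f 0 c 0))

/-- `foldBase`, extended from `[0,1)` to the line. -/
noncomputable def foldMap (f : ℝ → ℝ) (c a t x : ℝ) : ℝ :=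
  ⌊x⌋ + foldBase f c a t (Int.fract x)

namespace IsFold

variable {f : ℝ → ℝ} {c a t : ℝ}

theorem a_pos (hf : IsFold f c a) : 0 < a := hf.c_nonneg.trans_lt hf.c_lt

theorem level_nonneg (hf : IsFold f c a) : 0 ≤ foldLevel f c a :=
  le_min hf.a_pos.le (le_max_left _ _)

theorem level_le (f : ℝ → ℝ) (c a : ℝ) : foldLevel f c a ≤ a := min_le_left _ _

theorem cont2 (hf : IsFold f c a) : Continuous (fun y => 1 + a - f y) := by
  have := hf.cont
  fun_prop

theorem cont3 (hf : IsFold f c a) : Continuous (fun y => 1 + f (1 + a - y)) := by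
  have := hf.cont
  fun_prop

/-- The lower bound on `t` serves here: either `t = a`, or the infimum of `f` over `[0, c]` is at
most `t`, so that the truncated envelope starts at `t`. This makes the values at `0` and `1` differ
by exactly one. -/
theorem env1_left (hf : IsFold f c a) (ht : foldLevel f c a ≤ t) (hta : t ≤ a) {y : ℝ}
    (hy : y ≤ 0) : envelope f 0 c t a y = t := by
  rcases min_le_iff.1 ht with h | h
  · exact le_antisymm ((envelope_le hta y).trans h) (le_envelope y)
  · exact envelope_eq_lo hf.c_nonneg ((le_max_right _ _).trans h) hy

theorem env1_right (hf : IsFold f c a) (hta : t ≤ a) {y : ℝ} (hy : c ≤ y) :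
    envelope f 0 c t a y = a :=
  envelope_eq_hi hf.cont hf.c_nonneg hta ((hf.lt_one.le).trans hf.top) hy

theorem env2_left (hf : IsFold f c a) {y : ℝ} (hy : y ≤ c) :
    envelope (fun y => 1 + a - f y) c a a 1 y = a := by
  refine envelope_eq_lo hf.c_lt.le ?_ hy
  have := infAfter_le hf.cont2 le_rfl le_rfl hf.c_lt.le
  have := hf.top
  linarith

theorem env2_right (hf : IsFold f c a) {y : ℝ} (hy : a ≤ y) :
    envelope (fun y => 1 + a - f y) c a a 1 y = 1 :=
  envelope_eq_hi hf.cont2 hf.c_lt.le hf.lt_one.le (by rw [hf.fix]; linarith) hy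

theorem env3_left (hf : IsFold f c a) {y : ℝ} (hy : y ≤ a) :
    envelope (fun y => 1 + f (1 + a - y)) a 1 1 (1 + t) y = 1 := by
  refine envelope_eq_lo hf.lt_one.le ?_ hy
  have h1 := infAfter_le hf.cont3 le_rfl le_rfl hf.lt_one.le
  have h2 := hf.bot
  simp only [add_sub_cancel_right] at h1
  linarith

theorem env3_right (hf : IsFold f c a) (ht0 : 0 ≤ t) (hta : t ≤ a) {y : ℝ} (hy : 1 ≤ y) :
    envelope (fun y => 1 + f (1 + a - y)) a 1 1 (1 + t) y = 1 + t :=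
  envelope_eq_hi hf.cont3 hf.lt_one.le (by linarith) (by
    simp only [add_sub_cancel_left, hf.fix]; linarith) hy

/-- Off its own interval each of the three summands of `foldBase` is constant, and the subtracted `a
+ 1` cancels the two inactive ones. -/
theorem base_of_le_c (hf : IsFold f c a) {y : ℝ} (hy : y ≤ c) :
    foldBase f c a t y = envelope f 0 c t a y := by
  unfold foldBase
  rw [hf.env2_left hy, hf.env3_left (hy.trans hf.c_lt.le)]
  ring

theorem base_of_mem (hf : IsFold f c a) (hta : t ≤ a) {y : ℝ} (hy : c ≤ y) (hy' : y ≤ a) :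
    foldBase f c a t y = envelope (fun y => 1 + a - f y) c a a 1 y := by
  unfold foldBase
  rw [hf.env1_right hta hy, hf.env3_left hy']
  ring

theorem base_of_a_le (hf : IsFold f c a) (hta : t ≤ a) {y : ℝ} (hy : a ≤ y) :
    foldBase f c a t y = envelope (fun y => 1 + f (1 + a - y)) a 1 1 (1 + t) y := by
  unfold foldBase
  rw [hf.env1_right hta (hf.c_lt.le.trans hy), hf.env2_right hy]
  ring

theorem base_mono (hf : IsFold f c a) : Monotone (foldBase f c a t) := by
  intro y z hyz
  have h1 := envelope_mono (lo := t) (hi := a) hf.cont hf.c_nonneg hyz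
  have h2 := envelope_mono (lo := a) (hi := 1) hf.cont2 hf.c_lt.le hyz
  have h3 := envelope_mono (lo := 1) (hi := 1 + t) hf.cont3 hf.lt_one.le hyz
  unfold foldBase
  linarith

theorem base_zero (hf : IsFold f c a) (ht : foldLevel f c a ≤ t) (hta : t ≤ a) :
    foldBase f c a t 0 = t := by
  rw [hf.base_of_le_c hf.c_nonneg, hf.env1_left ht hta le_rfl]

theorem base_one (hf : IsFold f c a) (ht : foldLevel f c a ≤ t) (hta : t ≤ a) :
    foldBase f c a t 1 = 1 + t := by
  rw [hf.base_of_a_le hta hf.lt_one.le, hf.env3_right (hf.level_nonneg.trans ht) hta le_rfl]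

/-- The circle map of a fold at a level `t`. -/
noncomputable def lift (hf : IsFold f c a) (ht : foldLevel f c a ≤ t) (hta : t ≤ a) :
    CircleDeg1Lift where
  toFun := foldMap f c a t
  monotone' := by
    intro x y hxy
    unfold foldMap
    rcases (Int.floor_mono hxy).eq_or_lt with h | h
    · have : Int.fract x ≤ Int.fract y := by unfold Int.fract; rw [h]; linarith
      rw [h]
      have := hf.base_mono (t := t) this
      linarith
    · have h1 := hf.base_mono (t := t) (Int.fract_lt_one x).le
      have h2 := hf.base_mono (t := t) (Int.fract_nonneg y)
      rw [hf.base_one ht hta] at h1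
      rw [hf.base_zero ht hta] at h2
      have h3 : ((⌊x⌋ + 1 : ℤ) : ℝ) ≤ (⌊y⌋ : ℤ) := by exact_mod_cast h
      push_cast at h3
      linarith
  map_add_one' := by
    intro x
    unfold foldMap
    simp
    ring

theorem lift_apply (hf : IsFold f c a) (ht : foldLevel f c a ≤ t) (hta : t ≤ a) (x : ℝ) :
    hf.lift ht hta x = foldMap f c a t x := rfl

theorem foldMap_of_mem {y : ℝ} (h0 : 0 ≤ y) (h1 : y < 1) :
    foldMap f c a t y = foldBase f c a t y := by
  unfold foldMap
  rw [Int.floor_eq_zero_iff.2 ⟨h0, h1⟩, Int.fract_eq_self.2 ⟨h0, h1⟩]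
  simp

theorem foldMap_of_mem_Icc (hf : IsFold f c a) (ht : foldLevel f c a ≤ t) (hta : t ≤ a) {y : ℝ}
    (h0 : 0 ≤ y) (h1 : y ≤ 1) : foldMap f c a t y = foldBase f c a t y := by
  rcases h1.eq_or_lt with rfl | h
  · rw [hf.base_one ht hta]
    unfold foldMap
    simp [hf.base_zero ht hta]
  · exact foldMap_of_mem h0 h

/-- The displacement `foldBase f c a t y - y` equals `t` at both `0` and `1`, so it remains
continuous after composition with the fractional part. -/
theorem continuous_uncurry (hf : IsFold f c a) :
    Continuous (fun z : Set.Icc (foldLevel f c a) a × ℝ => foldMap f c a z.1 z.2) := by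
  have h : Continuous (fun z : Set.Icc (foldLevel f c a) a × ℝ =>
      foldBase f c a z.1 (Int.fract z.2) - Int.fract z.2) := by
    refine ContinuousOn.comp_fract
      (f := fun (z : Set.Icc (foldLevel f c a) a × ℝ) y => foldBase f c a z.1 y - y)
      (s := fun z => z.2) (Continuous.continuousOn ?_) continuous_snd ?_
    · refine Continuous.sub ?_ continuous_snd
      unfold foldBase
      have h1 : Continuous (fun z : (Set.Icc (foldLevel f c a) a × ℝ) × ℝ => (z.1.1 : ℝ)) := by
        fun_prop
      exact (((continuous_envelope hf.cont _ _ h1 continuous_const continuous_snd).add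
        (continuous_envelope hf.cont2 _ _ continuous_const continuous_const continuous_snd)).add
        (continuous_envelope hf.cont3 _ _ continuous_const (continuous_const.add h1)
          continuous_snd)).sub continuous_const |>.sub continuous_const
    · rintro ⟨⟨t, h1, h2⟩, x⟩
      simp only
      rw [hf.base_zero h1 h2, hf.base_one h1 h2]
      ring
  refine (h.add continuous_snd).congr fun z => ?_
  have := Int.floor_add_fract z.2
  simp only [Pi.add_apply]
  unfold foldMap
  linarith

theorem continuous_iterate (hf : IsFold f c a) (n : ℕ) :
    Continuous (fun z : Set.Icc (foldLevel f c a) a × ℝ => (foldMap f c a z.1)^[n] z.2) := by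
  induction n with
  | zero => exact continuous_snd
  | succ n ih =>
    simp only [Function.iterate_succ_apply']
    exact hf.continuous_uncurry.comp (continuous_fst.prodMk ih)

/-- At the highest level, the circle map has rotation number at least `1/2`. -/
theorem half_le_translationNumber (hf : IsFold f c a) (ht : foldLevel f c a ≤ a) :
    1 / 2 ≤ (hf.lift ht le_rfl).translationNumber := by
  set G := hf.lift ht le_rfl
  -- At the top level `0 ↦ a ↦ 1`: two steps make a full turn.
  have h0 : G 0 = a := by
    rw [hf.lift_apply, foldMap_of_mem le_rfl one_pos, hf.base_zero ht le_rfl]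
  have h1 : G a = 1 := by
    rw [hf.lift_apply, foldMap_of_mem hf.a_pos.le hf.lt_one,
      hf.base_of_a_le le_rfl le_rfl, hf.env3_left le_rfl]
  have h2 : (0 : ℝ) + ((1 : ℤ) : ℝ) ≤ (G ^ 2) 0 := by
    rw [pow_two, CircleDeg1Lift.mul_apply, h0, h1]
    norm_num
  have h3 := (G ^ 2).le_translationNumber_of_add_int_le h2
  rw [CircleDeg1Lift.translationNumber_pow] at h3
  push_cast at h3
  linarith

/-- If the least circle map has rotation number at most `p/q`, then at some level it has a
semistable periodic orbit of rotation number `p/q`. -/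
theorem exists_semistable (hf : IsFold f c a) {p q : ℕ} (hpq : 2 * p < q)
    (h : (hf.lift le_rfl (level_le f c a)).translationNumber ≤ (p : ℝ) / q) :
    ∃ (t : ℝ) (ht : foldLevel f c a ≤ t) (hta : t ≤ a) (x : ℝ),
      (hf.lift ht hta)^[q] x = x + p ∧ ∀ z, z + p ≤ (hf.lift ht hta)^[q] z := by
  have hq : (0 : ℝ) < q := by exact_mod_cast (by omega : 0 < q)
  let L := Set.Icc (foldLevel f c a) a
  let F : L × ℝ → ℝ := fun z => (foldMap f c a z.1)^[q] z.2
  have hF : Continuous F := hf.continuous_iterate q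
  let b : L := ⟨foldLevel f c a, le_rfl, level_le f c a⟩
  let e : L := ⟨a, level_le f c a, le_rfl⟩
  -- The compact set of levels and points that do not advance by more than `p` in `q` steps; the
  -- required level is the largest one occurring in it.
  let K : Set (L × ℝ) := {z | z.2 ∈ Set.Icc (0 : ℝ) 1 ∧ F z ≤ z.2 + p}
  have hK : IsCompact K := by
    have h1 : IsCompact ((Set.univ : Set L) ×ˢ Set.Icc (0 : ℝ) 1) := isCompact_univ.prod isCompact_Icc
    refine h1.of_isClosed_subset ?_ (fun z hz => ⟨trivial, hz.1⟩)
    exact (isClosed_Icc.preimage continuous_snd).inter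
      (isClosed_le hF (continuous_snd.add continuous_const))
  have hext : ∀ t : L, (∀ x ∈ Set.Icc (0 : ℝ) 1, (p : ℝ) ≤ F (t, x) - x) →
      ∀ x, x + p ≤ F (t, x) := by
    intro t ht x
    have := ((hf.lift t.2.1 t.2.2) ^ q).forall_map_sub_of_Icc (fun y => (p : ℝ) ≤ y) (by
      intro x hx
      rw [CircleDeg1Lift.coe_pow]
      exact ht x hx) x
    rw [CircleDeg1Lift.coe_pow] at this
    have h2 : F (t, x) = (hf.lift t.2.1 t.2.2)^[q] x := rfl
    rw [h2]
    linarith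
  -- Otherwise the least circle map advances every point by more than `p` in `q` steps, and by
  -- continuity its rotation number exceeds `p/q`.
  have hne : K.Nonempty := by
    by_contra hc
    rw [Set.not_nonempty_iff_eq_empty] at hc
    have h1 : ∀ x, x + (p : ℝ) < ((hf.lift le_rfl (level_le f c a)) ^ q) x := by
      intro x
      have := ((hf.lift le_rfl (level_le f c a)) ^ q).forall_map_sub_of_Icc
        (fun y => (p : ℝ) < y) (by
          intro x hx
          rw [CircleDeg1Lift.coe_pow]
          by_contra! hcon
          have : (b, x) ∈ K := ⟨hx, by
            have h2 : F (b, x) = (hf.lift le_rfl (level_le f c a))^[q] x := rfl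
            rw [h2]
            simp only
            linarith⟩
          rw [hc] at this
          exact this) x
      linarith
    have hcont : Continuous ((hf.lift le_rfl (level_le f c a)) ^ q : CircleDeg1Lift) := by
      rw [CircleDeg1Lift.coe_pow]
      exact hF.comp (Continuous.prodMk_right b)
    have h2 := CircleDeg1Lift.lt_translationNumber_of_forall_add_lt _ hcont h1
    rw [CircleDeg1Lift.translationNumber_pow] at h2
    rw [le_div_iff₀ hq] at h
    linarith
  obtain ⟨⟨t, x⟩, ⟨hx, hxt⟩, hmax⟩ := hK.exists_isMaxOn hne (f := fun z => (z.1 : ℝ)) (by fun_prop)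
  -- The top level is excluded because its rotation number is at least `1/2 > p/q`.
  have hta : (t : ℝ) < a := by
    refine lt_of_le_of_ne t.2.2 fun hc => ?_
    have hte : t = e := Subtype.ext hc
    rw [hte] at hxt
    have h1 := hf.half_le_translationNumber (level_le f c a)
    have h2 : ((hf.lift (level_le f c a) le_rfl) ^ q) x ≤ x + (p : ℕ) := by
      rw [CircleDeg1Lift.coe_pow]
      exact hxt
    have h3 := CircleDeg1Lift.translationNumber_le_of_le_add_nat _ h2
    rw [CircleDeg1Lift.translationNumber_pow] at h3
    have h4 : (2 : ℝ) * p < q := by exact_mod_cast hpq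
    nlinarith
  have hall : ∀ x, x + p ≤ F (t, x) := by
    refine hext t fun x hx => ?_
    by_contra! hc
    -- A strict inequality at level `t` would persist at slightly higher levels, against the
    -- maximality of `t`.
    have hcont : Continuous (fun s : L => F (s, x) - x) :=
      (hF.comp (Continuous.prodMk_left x)).sub continuous_const
    have hev : ∀ᶠ s : L in nhds t, F (s, x) - x < p :=
      (hcont.tendsto t).eventually_lt_const hc
    obtain ⟨ε, hε, hball⟩ := Metric.eventually_nhds_iff.1 hev
    let s : ℝ := min a (t + ε / 2)
    have hs1 : (t : ℝ) < s := lt_min hta (by linarith)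
    have hs : s ∈ L := ⟨t.2.1.trans hs1.le, min_le_left _ _⟩
    have h1 : F (⟨s, hs⟩, x) - x < p := by
      apply hball
      rw [Subtype.dist_eq, Real.dist_eq, abs_of_pos (by simpa using hs1)]
      have : s ≤ t + ε / 2 := min_le_right _ _
      simp only
      linarith
    have h2 : ((⟨s, hs⟩, x) : L × ℝ) ∈ K := ⟨hx, by simp only; linarith⟩
    have h3 : s ≤ t := hmax h2
    linarith
  exact ⟨t, t.2.1, t.2.2, x, le_antisymm hxt (hall x), hall⟩

end IsFold

/-! ## Ordering of periodic orbits of circle maps -/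

namespace CircleDeg1Lift

variable (G : CircleDeg1Lift) {p q : ℕ} {x : ℝ}

theorem iterate_add_of_periodic (hx : G^[q] x = x + p) (i : ℕ) :
    G^[q] (G^[i] x) = G^[i] x + p := by
  rw [← Function.iterate_add_apply, add_comm, Function.iterate_add_apply, hx, ← coe_pow,
    map_add_nat]

theorem iterate_mul_of_periodic (hx : G^[q] x = x + p) (d : ℕ) :
    G^[q * d] x = x + d * p := by
  rw [Function.iterate_mul]
  have h : (G ^ q) x = x + (p : ℤ) := by rw [coe_pow, hx]; simp
  have := (G ^ q).iterate_eq_of_map_eq_add_int h d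
  rw [coe_pow] at this
  simpa using this

/-- Iterating the inequality `q` times compares it with the known value of `G^[q * d] x`. -/
theorem mul_le_of_le_iterate (hx : G^[q] x = x + p) {d : ℕ} {m : ℤ} (h : x + m ≤ G^[d] x) :
    m * q ≤ d * p := by
  rw [← coe_pow] at h
  have := (G ^ d).le_iterate_of_add_int_le_map h q
  rw [coe_pow, ← Function.iterate_mul, mul_comm d q, G.iterate_mul_of_periodic hx] at this
  have h2 : (q : ℝ) * m ≤ d * p := by linarith
  have h3 : (q : ℤ) * m ≤ d * p := by exact_mod_cast h2
  linarith

theorem mul_le_of_iterate_le (hx : G^[q] x = x + p) {d : ℕ} {m : ℤ} (h : G^[d] x ≤ x + m) :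
    d * p ≤ m * q := by
  rw [← coe_pow] at h
  have := (G ^ d).iterate_le_of_map_le_add_int h q
  rw [coe_pow, ← Function.iterate_mul, mul_comm d q, G.iterate_mul_of_periodic hx] at this
  have h2 : (d : ℝ) * p ≤ q * m := by linarith
  have h3 : (d : ℤ) * p ≤ q * m := by exact_mod_cast h2
  linarith

/-- The lifted orbit point `G^[i] x + k` is labelled by its place `i * p + k * q` in the orbit of a
rotation. Comparing two points amounts to comparing one point with its image after `|i - j|` steps.
-/
theorem orbit_index_le (hx : G^[q] x = x + p) {i j : ℕ} {k l : ℤ}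
    (h : G^[j] x + l ≤ G^[i] x + k) : j * p + l * q ≤ i * p + k * q := by
  rcases le_total j i with hij | hij
  · obtain ⟨d, rfl⟩ := Nat.exists_eq_add_of_le hij
    have := G.mul_le_of_le_iterate (G.iterate_add_of_periodic hx j) (d := d) (m := l - k) (by
      rw [← Function.iterate_add_apply, add_comm d]
      push_cast
      linarith)
    push_cast
    linarith
  · obtain ⟨d, rfl⟩ := Nat.exists_eq_add_of_le hij
    have := G.mul_le_of_iterate_le (G.iterate_add_of_periodic hx i) (d := d) (m := k - l) (by
      rw [← Function.iterate_add_apply, add_comm d]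
      push_cast
      linarith)
    push_cast
    linarith

theorem orbit_eq_of_index_eq (hx : G^[q] x = x + p) (hq : 0 < q) (hcop : p.Coprime q) {i j : ℕ}
    {k l : ℤ} (h : (i * p + k * q : ℤ) = j * p + l * q) : G^[i] x + k = G^[j] x + l := by
  wlog hij : i ≤ j generalizing i j k l
  · exact (this h.symm (le_of_not_ge hij)).symm
  obtain ⟨d, rfl⟩ := Nat.exists_eq_add_of_le hij
  have h1 : (d : ℤ) * p = (k - l) * q := by push_cast at h; linarith
  have h2 : (q : ℤ) ∣ d := by
    refine IsCoprime.dvd_of_dvd_mul_right (Nat.isCoprime_iff_coprime.2 hcop.symm) ⟨k - l, ?_⟩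
    rw [h1]
    ring
  obtain ⟨r, rfl⟩ := Int.natCast_dvd_natCast.1 h2
  have h3 : (r : ℤ) * p = k - l := by
    have : (q : ℤ) ≠ 0 := by exact_mod_cast hq.ne'
    apply mul_right_cancel₀ this
    rw [← h1]
    push_cast
    ring
  have h4 : (r : ℝ) * p = k - l := by exact_mod_cast h3
  rw [add_comm i, Function.iterate_add_apply,
    G.iterate_mul_of_periodic (G.iterate_add_of_periodic hx i)]
  linarith

/-- A periodic orbit of a monotone circle map of degree one is ordered as that of a rotation. -/
theorem exists_strictMono_orbit (hq : 0 < q) (hcop : p.Coprime q) (hx : G^[q] x = x + p) :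
    ∃ Z : ℤ → ℝ, StrictMono Z ∧ (∀ N, Z (N + q) = Z N + 1) ∧ (∀ N, G (Z N) = Z (N + p)) ∧
      ∀ N, ∃ (i : ℕ) (k : ℤ), Z N = G^[i] x + k := by
  -- Bézout coefficients, with a multiple of `q` added to the first to make it a number of
  -- iterations.
  have hex : ∀ N : ℤ, ∃ (i : ℕ) (k : ℤ), (i * p + k * q : ℤ) = N := by
    intro N
    obtain ⟨u, v, huv⟩ := Nat.isCoprime_iff_coprime.2 hcop
    have hpos : 0 ≤ N * u + |N * u| * q := by
      have h1 : (1 : ℤ) ≤ q := by exact_mod_cast hq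
      have h2 := neg_abs_le (N * u)
      have h3 := abs_nonneg (N * u)
      nlinarith
    refine ⟨(N * u + |N * u| * q).toNat, N * v - |N * u| * p, ?_⟩
    rw [Int.toNat_of_nonneg hpos]
    linear_combination N * huv
  choose i k hik using hex
  refine ⟨fun N => G^[i N] x + k N, ?_, ?_, ?_, fun N => ⟨_, _, rfl⟩⟩
  · intro M N hMN
    by_contra! hc
    have := G.orbit_index_le hx hc
    rw [hik, hik] at this
    omega
  · intro N
    have := G.orbit_eq_of_index_eq hx hq hcop (i := i (N + q)) (j := i N) (k := k (N + q))
      (l := k N + 1) (by rw [hik, add_mul, ← add_assoc, hik, one_mul])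
    simp only [this]
    push_cast
    ring
  · intro N
    have := G.orbit_eq_of_index_eq hx hq hcop (i := i (N + p)) (j := i N + 1) (k := k (N + p))
      (l := k N) (by
        rw [hik]
        push_cast
        linarith [hik N])
    simp only [this, map_add_int, Function.iterate_succ_apply']

end CircleDeg1Lift

/-! ## Recognition of the pattern `γ_{p/q}` -/

/-- A cycle which becomes a rotation of `q` points by `p` places when its points to the right of
`a` are flipped has the pattern `γ_{p/q}`. -/
theorem exists_gamma_of_rotation {f : ℝ → ℝ} {p q : ℕ} (hp : 0 < p) (hpq : 2 * p ≤ q)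
    {a κ : ℝ} {Z : ℕ → ℝ} (hZ : ∀ M N, M < N → N < q → Z M < Z N)
    (hleft : ∀ N, N + p < q → Z N < a) (hright : ∀ N, q ≤ N + p → N < q → a < κ - Z N)
    (h1 : ∀ N, N + 2 * p < q → f (Z N) = Z (N + p))
    (h2 : ∀ N, q ≤ N + 2 * p → N + p < q → f (Z N) = κ - Z (N + p))
    (h3 : ∀ N, q ≤ N + p → N < q → f (κ - Z N) = Z (N + p - q)) :
    ∃ e : Fin q → ℝ, StrictMono e ∧ (∀ i, f (e i) = e (gammaPerm p q hpq i)) ∧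
      ∀ i, (∃ N, N + p < q ∧ e i = Z N) ∨ ∃ N, q ≤ N + p ∧ N < q ∧ e i = κ - Z N := by
  -- The flip reverses the last `p` points, hence the index `2 * q - p - 1 - j`.
  let E : ℕ → ℝ := fun j => if j + p < q then Z j else κ - Z (2 * q - p - 1 - j)
  have hE1 : ∀ j, j + p < q → E j = Z j := fun j hj => if_pos hj
  have hE2 : ∀ j, q ≤ j + p → E j = κ - Z (2 * q - p - 1 - j) := fun j hj => if_neg (by omega)
  refine ⟨fun j => E j, ?_, ?_, ?_⟩
  · rintro ⟨i, hi⟩ ⟨j, hj⟩ hij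
    simp only [Fin.mk_lt_mk] at hij ⊢
    rcases lt_or_ge (j + p) q with hj' | hj'
    · rw [hE1 i (by omega), hE1 j hj']
      exact hZ _ _ hij hj
    · rcases lt_or_ge (i + p) q with hi' | hi'
      · rw [hE1 i hi', hE2 j hj']
        exact (hleft i hi').trans (hright _ (by omega) (by omega))
      · rw [hE2 i hi', hE2 j hj']
        have := hZ (2 * q - p - 1 - j) (2 * q - p - 1 - i) (by omega) (by omega)
        linarith
  · rintro ⟨j, hj⟩
    change f (E j) = E (gammaFun p q j)
    unfold gammaFun
    split_ifs with hj1 hj2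
    · rw [hE1 j (by omega), hE1 (j + p) (by omega), h1 j hj1]
    · rw [hE1 j hj2, hE2 _ (by omega), h2 j (by omega) hj2]
      congr 2
      omega
    · rw [hE2 j (by omega), hE1 _ (by omega), h3 _ (by omega) (by omega)]
      congr 1
      omega
  · rintro ⟨j, hj⟩
    rcases lt_or_ge (j + p) q with hj' | hj'
    · exact Or.inl ⟨j, hj', hE1 j hj'⟩
    · exact Or.inr ⟨2 * q - p - 1 - j, by omega, by omega, hE2 j hj'⟩

/-! ### From semistable orbits of the circle map to cycles of the fold -/

namespace IsFold

variable {f : ℝ → ℝ} {c a t : ℝ}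

/-- Where the circle map of a fold increases to the right, it comes from the fold. -/
theorem lift_eq_apply (hf : IsFold f c a) (ht : foldLevel f c a ≤ t) (hta : t ≤ a) {y : ℝ}
    (h0 : 0 ≤ y) (h1 : y < 1) (hy : ∀ z, y < z → hf.lift ht hta y < hf.lift ht hta z) :
    (y < a ∧ 0 ≤ hf.lift ht hta y ∧ hf.lift ht hta y < 1 ∧
      (hf.lift ht hta y < a ∧ f y = hf.lift ht hta y ∨
        a ≤ hf.lift ht hta y ∧ f y = 1 + a - hf.lift ht hta y)) ∨
    (a ≤ y ∧ 1 ≤ hf.lift ht hta y ∧ hf.lift ht hta y < 1 + a ∧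
        f (1 + a - y) = hf.lift ht hta y - 1) := by
  have hG : ∀ z, 0 ≤ z → z ≤ 1 → hf.lift ht hta z = foldBase f c a t z := fun z h h' =>
    hf.foldMap_of_mem_Icc ht hta h h'
  have ht0 := hf.level_nonneg.trans ht
  have hac := hf.c_lt
  have ha1 := hf.lt_one
  have hc0 := hf.c_nonneg
  rcases lt_or_ge y c with hyc | hyc
  · obtain ⟨e1, e2, e3⟩ := envelope_eq_apply (lo := t) (hi := a) hf.cont h0 hyc (by
      intro z hz hzc
      have := hy z hz
      rwa [hG y h0 h1.le, hG z (h0.trans hz.le) (by linarith), hf.base_of_le_c hyc.le,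
        hf.base_of_le_c hzc] at this)
    rw [hG y h0 h1.le, hf.base_of_le_c hyc.le]
    left
    refine ⟨by linarith, by linarith, by linarith, Or.inl ⟨by linarith, e1.symm⟩⟩
  rcases lt_or_ge y a with hya | hya
  · obtain ⟨e1, e2, e3⟩ := envelope_eq_apply (lo := a) (hi := 1) hf.cont2 hyc hya (by
      intro z hz hza
      have := hy z hz
      rwa [hG y h0 h1.le, hG z (h0.trans hz.le) (by linarith), hf.base_of_mem hta hyc hya.le,
        hf.base_of_mem hta (by linarith) hza] at this)
    rw [hG y h0 h1.le, hf.base_of_mem hta hyc hya.le]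
    left
    refine ⟨hya, by linarith, by linarith, Or.inr ⟨by linarith, by linarith⟩⟩
  · obtain ⟨e1, e2, e3⟩ := envelope_eq_apply (lo := 1) (hi := 1 + t) hf.cont3 hya h1 (by
      intro z hz hz1
      have := hy z hz
      rwa [hG y h0 h1.le, hG z (h0.trans hz.le) hz1, hf.base_of_a_le hta hya,
        hf.base_of_a_le hta (by linarith)] at this)
    rw [hG y h0 h1.le, hf.base_of_a_le hta hya]
    right
    refine ⟨hya, by linarith, by linarith, by linarith⟩

theorem exists_gamma (hf : IsFold f c a) {p q : ℕ} (hp : 0 < p) (hpq : 2 * p < q)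
    (hcop : p.Coprime q)
    (h : (hf.lift le_rfl (level_le f c a)).translationNumber ≤ (p : ℝ) / q) :
    ∃ e : Fin q → ℝ, StrictMono e ∧ (∀ i, f (e i) = e (gammaPerm p q hpq.le i)) ∧
      ∀ i, e i ∈ Set.Icc (0 : ℝ) 1 := by
  obtain ⟨t, ht, hta, x, hx, hall⟩ := hf.exists_semistable hpq h
  set G := hf.lift ht hta with hGdef
  have hq : 0 < q := by omega
  have hqz : (0 : ℤ) < q := by exact_mod_cast hq
  obtain ⟨Z₀, hmono₀, hper₀, hmap₀, horb₀⟩ := G.exists_strictMono_orbit hq hcop hx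
  have hper_mul : ∀ (N : ℤ) (k : ℕ), Z₀ (N + k * q) = Z₀ N + k := by
    intro N k
    induction k with
    | zero => simp
    | succ k ih =>
      have := hper₀ (N + k * q)
      rw [ih] at this
      push_cast
      rw [← add_assoc, ← this]
      congr 1
      ring
  -- Numbering from the first nonnegative point puts the first `q` points in `[0, 1)`.
  obtain ⟨N₀, hN₀, hmin⟩ : ∃ N₀ : ℤ, 0 ≤ Z₀ N₀ ∧ ∀ N, 0 ≤ Z₀ N → N₀ ≤ N := by
    refine Int.exists_least_of_bdd ?_ ?_
    · obtain ⟨k, hk⟩ := exists_nat_gt (Z₀ 0)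
      refine ⟨-(k * q), fun N hN => ?_⟩
      by_contra! hc
      have h1 := hmono₀ hc
      have h2 := hper_mul (-(k * q)) k
      rw [neg_add_cancel] at h2
      linarith
    · obtain ⟨k, hk⟩ := exists_nat_gt (-Z₀ 0)
      refine ⟨0 + k * q, ?_⟩
      rw [hper_mul]
      linarith
  have hZ0 : ∀ N : ℕ, 0 ≤ Z₀ (N₀ + N) := fun N => hN₀.trans (hmono₀.monotone (by omega))
  have hZ1 : ∀ N : ℕ, N < q → Z₀ (N₀ + N) < 1 := by
    intro N hN
    have h1 : Z₀ (N₀ - 1) < 0 := by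
      by_contra! hc
      have := hmin _ hc
      omega
    have h2 := hper₀ (N₀ - 1)
    have h3 : Z₀ (N₀ + N) ≤ Z₀ (N₀ - 1 + q) := hmono₀.monotone (by omega)
    linarith
  have hZge : ∀ N : ℕ, q ≤ N → 1 ≤ Z₀ (N₀ + N) := by
    intro N hN
    have h2 := hper₀ N₀
    have h3 : Z₀ (N₀ + q) ≤ Z₀ (N₀ + N) := hmono₀.monotone (by omega)
    linarith
  -- If `G z = G (Z₀ N)` with `z > Z₀ N`, then `G^[q] z = Z₀ N + p < z + p`, against semistability.
  have hincr : ∀ N z, Z₀ N < z → G (Z₀ N) < G z := by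
    intro N z hz
    refine lt_of_le_of_ne (G.mono hz.le) fun hc => ?_
    obtain ⟨i, k, hik⟩ := horb₀ N
    have h1 : G^[q] (Z₀ N) = Z₀ N + p := by
      rw [hik, ← CircleDeg1Lift.coe_pow, CircleDeg1Lift.map_add_int, CircleDeg1Lift.coe_pow,
        G.iterate_add_of_periodic hx]
      ring
    have h2 : G^[q] z = G^[q] (Z₀ N) := by
      obtain ⟨r, rfl⟩ := Nat.exists_eq_succ_of_ne_zero hq.ne'
      rw [Function.iterate_succ_apply, Function.iterate_succ_apply, hc]
    have h3 := hall z
    linarith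
  have hstep : ∀ N : ℕ, G (Z₀ (N₀ + N)) = Z₀ (N₀ + (N + p : ℕ)) := by
    intro N
    rw [hmap₀]
    congr 1
    push_cast
    ring
  have hloc := fun (N : ℕ) (hN : N < q) =>
    hf.lift_eq_apply ht hta (hZ0 N) (hZ1 N hN) (hincr _)
  simp only [← hGdef, hstep] at hloc
  -- A point lies to the left of `a` exactly when its image under `G` has not yet reached `1`, that
  -- is, when `N + p < q`.
  have hleft : ∀ N : ℕ, N + p < q → Z₀ (N₀ + N) < a := by
    intro N hN
    rcases hloc N (by omega) with h1 | h1
    · exact h1.1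
    · have := hZ1 (N + p) hN
      linarith [h1.2.1]
  have hright : ∀ N : ℕ, q ≤ N + p → N < q → a ≤ Z₀ (N₀ + N) := by
    intro N hN hNq
    rcases hloc N hNq with h1 | h1
    · have := hZge (N + p) hN
      linarith [h1.2.2.1]
    · exact h1.1
  obtain ⟨e, he, hfe, hval⟩ := exists_gamma_of_rotation (f := f) hp hpq.le (a := a) (κ := 1 + a)
    (Z := fun N : ℕ => Z₀ (N₀ + N)) (fun M N hMN _ => hmono₀ (by omega)) hleft
    (fun N _ hN => by linarith [hZ1 N hN])
    (fun N hN => by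
      rcases hloc N (by omega) with ⟨-, -, -, h1 | h1⟩ | h1
      · exact h1.2
      · linarith [hleft (N + p) (by omega)]
      · linarith [hleft N (by omega)])
    (fun N hN hN' => by
      rcases hloc N (by omega) with ⟨-, -, -, h1 | h1⟩ | h1
      · linarith [hright (N + p) (by omega) (by omega)]
      · exact h1.2
      · linarith [hleft N (by omega)])
    (fun N hN hN' => by
      rcases hloc N hN' with h1 | h1
      · linarith [hright N hN hN']
      · have h2 := hper₀ (N₀ + (N + p - q : ℕ))
        rw [h1.2.2.2, sub_eq_iff_eq_add, ← h2]
        congr 1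
        omega)
  refine ⟨e, he, hfe, fun i => ?_⟩
  rcases hval i with ⟨N, hN, h1⟩ | ⟨N, hN, hN', h1⟩
  · rw [h1]
    exact ⟨hZ0 N, (hZ1 N (by omega)).le⟩
  · have h2 := hright N hN hN'
    have h3 := hZ1 N hN'
    have h4 := hf.a_pos
    rw [h1]
    constructor <;> linarith

end IsFold

/-! ## Over-rotation numbers and the sides of a fixed point -/

theorem chi_congr {X : Type} {v w : X → ℝ} (h : ∀ x y, v x < v y ↔ w x < w y) (g : X → X)
    (x : X) : chi v g x = chi w g x := by
  have key : (v (g x) - v x) * (v (g (g x)) - v (g x)) ≤ 0 ↔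
      (w (g x) - w x) * (w (g (g x)) - w (g x)) ≤ 0 := by
    have h' : ∀ x y, v x ≤ v y ↔ w x ≤ w y := fun x y => by simp only [← not_lt, h]
    rw [mul_nonpos_iff, mul_nonpos_iff]
    simp only [sub_nonneg, sub_nonpos, h']
  unfold chi
  simp only [key]

/-- If `g` moves to the right the points to the left of `a`, and sends the points to the right of
`a` to its left, then `χ` is the average of two values of the indicator of the right side. -/
theorem chi_eq_of_sides {X : Type} {v : X → ℝ} {g : X → X} {a : ℝ} {x : X} (hx : v x ≠ a)
    (hgx : v (g x) ≠ a) (hl : v x < a → v x < v (g x))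
    (hl' : v (g x) < a → v (g x) < v (g (g x))) (hr : a < v x → v (g x) < a)
    (hr' : a < v (g x) → v (g (g x)) < a) :
    chi v g x = ((if a < v x then (1 : ℝ) else 0) + (if a < v (g x) then (1 : ℝ) else 0)) / 2 := by
  unfold chi
  rcases hx.lt_or_gt with h1 | h1 <;> rcases hgx.lt_or_gt with h2 | h2
  · have := mul_pos (sub_pos.2 (hl h1)) (sub_pos.2 (hl' h2))
    rw [if_neg this.not_ge, if_neg h1.not_gt, if_neg h2.not_gt]
    norm_num
  · have := mul_neg_of_pos_of_neg (sub_pos.2 (hl h1)) (sub_neg.2 ((hr' h2).trans h2))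
    rw [if_pos this.le, if_neg h1.not_gt, if_pos h2]
    norm_num
  · have := mul_neg_of_neg_of_pos (sub_neg.2 ((hr h1).trans h1)) (sub_pos.2 (hl' h2))
    rw [if_pos this.le, if_pos h1, if_neg h2.not_gt]
    norm_num
  · exact absurd (hr h1) h2.not_gt

theorem chi_nonneg {X : Type} (v : X → ℝ) (g : X → X) (x : X) : 0 ≤ chi v g x := by
  unfold chi
  split_ifs <;> norm_num

theorem chi_le_half {X : Type} (v : X → ℝ) (g : X → X) (x : X) : chi v g x ≤ 1 / 2 := by
  unfold chi
  split_ifs <;> norm_num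

/-- Each `χ` averages the indicators at a point and at its image; over a permutation both halves
have the same sum. -/
theorem sum_chi_eq_sum_right {n : ℕ} {σ : Equiv.Perm (Fin n)} {v : Fin n → ℝ} {a : ℝ}
    (hne : ∀ i, v i ≠ a) (hl : ∀ i, v i < a → v i < v (σ i)) (hr : ∀ i, a < v i → v (σ i) < a) :
    ∑ i, chi v σ i = ∑ i, if a < v i then (1 : ℝ) else 0 := by
  have h1 : ∀ i, chi v σ i =
      ((if a < v i then (1 : ℝ) else 0) + (if a < v (σ i) then (1 : ℝ) else 0)) / 2 := fun i =>
    chi_eq_of_sides (hne i) (hne _) (hl i) (hl _) (hr i) (hr _)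
  simp only [h1]
  rw [← Finset.sum_div, Finset.sum_add_distrib,
    Equiv.sum_comp σ (fun i => if a < v i then (1 : ℝ) else 0)]
  ring

theorem sum_chi_iterate_eq_sum_right {X : Type} {g : X → X} {v : X → ℝ} {a : ℝ} {y : X} {n : ℕ}
    (hn : g^[n] y = y) (hne : ∀ i, v (g^[i] y) ≠ a)
    (hl : ∀ i, v (g^[i] y) < a → v (g^[i] y) < v (g^[i + 1] y))
    (hr : ∀ i, a < v (g^[i] y) → v (g^[i + 1] y) < a) :
    ∑ i ∈ Finset.range n, chi v g (g^[i] y) =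
      ∑ i ∈ Finset.range n, if a < v (g^[i] y) then (1 : ℝ) else 0 := by
  have h1 : ∀ i, chi v g (g^[i] y) =
      ((if a < v (g^[i] y) then (1 : ℝ) else 0) +
        (if a < v (g^[i + 1] y) then (1 : ℝ) else 0)) / 2 := by
    intro i
    have e1 := hl i
    have e2 := hl (i + 1)
    have e3 := hr i
    have e4 := hr (i + 1)
    have e5 := hne i
    have e6 := hne (i + 1)
    simp only [Function.iterate_succ_apply'] at e1 e2 e3 e4 e5 e6 ⊢
    exact chi_eq_of_sides e5 e6 e1 e2 e3 e4
  simp only [h1]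
  rw [← Finset.sum_div, Finset.sum_add_distrib]
  -- By periodicity the sum shifted by one step equals the original one.
  have h2 := Finset.sum_range_succ (fun i => if a < v (g^[i] y) then (1 : ℝ) else 0) n
  rw [Finset.sum_range_succ', hn] at h2
  rw [← add_right_cancel h2]
  ring

namespace Pattern

theorem sum_range_pow (π : Pattern) (i₀ : Fin π.n) (h : Fin π.n → ℝ) :
    ∑ k ∈ Finset.range π.n, h ((π.perm ^ k) i₀) = ∑ i, h i := by
  have hc : π.perm.IsCycleOn ((Finset.univ : Finset (Fin π.n)) : Set (Fin π.n)) := by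
    simpa using π.cyclic
  refine Finset.sum_bij (fun k _ => (π.perm ^ k) i₀) (fun _ _ => Finset.mem_univ _) ?_ ?_
    (fun _ _ => rfl)
  · intro k hk l hl hkl
    have := (hc.pow_apply_eq_pow_apply (Finset.mem_univ i₀)).1 hkl
    rw [Finset.card_univ, Fintype.card_fin] at this
    exact this.eq_of_lt_of_lt (Finset.mem_range.1 hk) (Finset.mem_range.1 hl)
  · intro i _
    obtain ⟨k, hk, hki⟩ := hc.exists_pow_eq (Finset.mem_univ i₀) (Finset.mem_univ i)
    rw [Finset.card_univ, Fintype.card_fin] at hk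
    exact ⟨k, Finset.mem_range.2 hk, hki⟩

theorem iterate_apply {X : Type*} {π : Pattern} {f : X → X} {e : Fin π.n → X}
    (hf : ∀ i, f (e i) = e (π.perm i)) (k : ℕ) (i : Fin π.n) :
    f^[k] (e i) = e ((π.perm ^ k) i) := by
  induction k with
  | zero => simp
  | succ k ih => rw [Function.iterate_succ_apply', ih, hf, pow_succ', Equiv.Perm.mul_apply]

theorem pow_n_apply (π : Pattern) (i : Fin π.n) : (π.perm ^ π.n) i = i := by
  have hc : π.perm.IsCycleOn ((Finset.univ : Finset (Fin π.n)) : Set (Fin π.n)) := by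
    simpa using π.cyclic
  rw [hc.pow_apply_eq (Finset.mem_univ i), Finset.card_univ, Fintype.card_fin]

theorem minimalPeriod_eq {X : Type*} {π : Pattern} {f : X → X} {e : Fin π.n → X}
    (he : Function.Injective e) (hf : ∀ i, f (e i) = e (π.perm i)) (i : Fin π.n) :
    Function.minimalPeriod f (e i) = π.n := by
  have hc : π.perm.IsCycleOn ((Finset.univ : Finset (Fin π.n)) : Set (Fin π.n)) := by
    simpa using π.cyclic
  refine Nat.dvd_antisymm ?_ ?_
  · rw [← Function.isPeriodicPt_iff_minimalPeriod_dvd]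
    change f^[π.n] (e i) = e i
    rw [iterate_apply hf, pow_n_apply]
  · have h1 : f^[Function.minimalPeriod f (e i)] (e i) = e i :=
      Function.isPeriodicPt_minimalPeriod f (e i)
    rw [iterate_apply hf] at h1
    have := (hc.pow_apply_eq (Finset.mem_univ i)).1 (he h1)
    rwa [Finset.card_univ, Fintype.card_fin] at this

/-- The over-rotation number of a pattern can be computed from any order-isomorphic cycle. -/
theorem overRotationNumber_eq (π : Pattern) {v : Fin π.n → ℝ} (hv : StrictMono v) :
    π.overRotationNumber = (∑ i, chi v π.perm i) / π.n := by
  unfold overRotationNumber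
  congr 1
  refine Finset.sum_congr rfl fun i _ => chi_congr (fun x y => ?_) _ _
  rw [hv.lt_iff_lt, Nat.cast_lt, Fin.lt_def]

theorem overRotationNumber_eq_of_sides (π : Pattern) {v : Fin π.n → ℝ} (hv : StrictMono v) {a : ℝ}
    (hne : ∀ i, v i ≠ a) (hl : ∀ i, v i < a → v i < v (π.perm i))
    (hr : ∀ i, a < v i → v (π.perm i) < a) :
    π.overRotationNumber = (∑ i, if a < v i then (1 : ℝ) else 0) / π.n := by
  rw [π.overRotationNumber_eq hv, sum_chi_eq_sum_right hne hl hr]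

theorem perm_ne (π : Pattern) (hn : 2 ≤ π.n) (i : Fin π.n) : π.perm i ≠ i := by
  have : Nontrivial (Fin π.n) := Fin.nontrivial_iff_two_le.2 hn
  exact π.cyclic.apply_ne Set.nontrivial_univ (Set.mem_univ i)

end Pattern

theorem Exhibits.exists_periodicPt {f : unitInterval → unitInterval} {π : Pattern} (hn : 2 ≤ π.n)
    (h : Exhibits f π) : ∃ y : unitInterval, y ∈ Function.periodicPts f ∧ f y ≠ y ∧
      overRotationNumber f y = π.overRotationNumber := by
  obtain ⟨e, he, hf⟩ := h
  let i₀ : Fin π.n := ⟨0, π.pos⟩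
  have hmin := Pattern.minimalPeriod_eq he.injective hf i₀
  refine ⟨e i₀, ?_, ?_, ?_⟩
  · rw [← Function.minimalPeriod_pos_iff_mem_periodicPts, hmin]
    exact π.pos
  · rw [hf]
    exact fun hc => π.perm_ne hn i₀ (he.injective hc)
  · have hv : StrictMono (fun i => ((e i : unitInterval) : ℝ)) := fun i j hij => he hij
    rw [π.overRotationNumber_eq hv, overRotationNumber, hmin, ← π.sum_range_pow i₀]
    congr 1
    refine Finset.sum_congr rfl fun k _ => ?_
    rw [Pattern.iterate_apply hf]
    unfold chi
    simp only [hf]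

/-! ## Orbits of a fold bound the rotation number of its circle map -/

namespace IsFold

variable {f : ℝ → ℝ} {c a t : ℝ}

/-- In the flipped coordinate `u` the orbit moves at least as far as `G` does, once a full turn is
added for each visit to the right of `a`. After `n` steps the orbit closes up, and the number of
turns bounds the displacement of `G^[n]`. -/
theorem translationNumber_le_of_orbit (hf : IsFold f c a) {y : ℕ → ℝ}
    (hy : ∀ i, y (i + 1) = f (y i)) (hmem : ∀ i, y i ∈ Set.Icc (0 : ℝ) 1) (hne : ∀ i, y i ≠ a)
    (hmid : ∀ i, c ≤ y i → y i < a → a < y (i + 1)) (hr : ∀ i, a < y i → y (i + 1) < a)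
    {n : ℕ} (hn : 0 < n) (hper : y n = y 0) :
    (hf.lift le_rfl (level_le f c a)).translationNumber ≤
      (∑ i ∈ Finset.range n, if a < y i then (1 : ℝ) else 0) / n := by
  set G := hf.lift le_rfl (level_le f c a) with hG
  let u : ℕ → ℝ := fun i => if a < y i then 1 + a - y i else y i
  have hcast : ∀ m : ℕ, (∑ i ∈ Finset.range m, if a < y i then (1 : ℝ) else 0) =
      ((∑ i ∈ Finset.range m, if a < y i then 1 else 0 : ℕ) : ℝ) := by
    intro m
    push_cast
    rfl
  have hac := hf.c_lt
  have ha1 := hf.lt_one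
  have hc0 := hf.c_nonneg
  have hstep : ∀ i, G (u i) ≤ u (i + 1) + if a < y i then 1 else 0 := by
    intro i
    have hm1 := hmem i
    have hm2 := hmem (i + 1)
    rcases (hne i).lt_or_gt with h1 | h1
    · have e1 : u i = y i := if_neg h1.not_gt
      have e2 : G (u i) = foldBase f c a (foldLevel f c a) (y i) := by
        rw [e1]
        exact hf.foldMap_of_mem_Icc le_rfl (level_le f c a) hm1.1 hm1.2
      rw [if_neg h1.not_gt, e2, add_zero]
      rcases (hne (i + 1)).lt_or_gt with h2 | h2
      · have hyc : y i ≤ c := by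
          by_contra! hc
          exact absurd (hmid i hc.le h1) h2.not_gt
        have e3 : u (i + 1) = f (y i) := (if_neg h2.not_gt).trans (hy i)
        rw [e3, hf.base_of_le_c hyc]
        refine envelope_le_apply hf.cont hm1.1 hyc ?_
        refine (min_le_right _ _).trans (max_le ?_ (infAfter_le hf.cont le_rfl hm1.1 hyc))
        rw [← hy i]
        exact hm2.1
      · have e3 : u (i + 1) = 1 + a - y (i + 1) := if_pos h2
        rw [e3]
        -- From `[0, c]` the orbit may also cross `a`; the envelope is capped at `a` there, while
        -- the flipped image is at least `a`.
        rcases le_or_gt (y i) c with hyc | hyc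
        · rw [hf.base_of_le_c hyc]
          have := envelope_le (h := f) (l := 0) (r := c) (level_le f c a) (y i)
          linarith [hm2.2]
        · rw [hf.base_of_mem (level_le f c a) hyc.le h1.le, hy i]
          refine envelope_le_apply hf.cont2 hyc.le h1.le ?_
          rw [← hy i]
          linarith [hm2.2]
    · have e1 : u i = 1 + a - y i := if_pos h1
      have h2 := hr i h1
      have e3 : u (i + 1) = y (i + 1) := if_neg h2.not_gt
      have e2 : G (u i) = foldBase f c a (foldLevel f c a) (1 + a - y i) := by
        rw [e1]
        exact hf.foldMap_of_mem_Icc le_rfl (level_le f c a) (by linarith [hm1.2, hf.a_pos])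
          (by linarith)
      rw [if_pos h1, e2, e3, hf.base_of_a_le (level_le f c a) (by linarith [hm1.2])]
      have e4 := envelope_le_apply (lo := 1) (hi := 1 + foldLevel f c a) hf.cont3
        (y := 1 + a - y i) (l := a) (r := 1) (by linarith [hm1.2]) (by linarith) (by
          simp only [sub_sub_cancel]
          rw [← hy i]
          linarith [hm2.1])
      simp only [sub_sub_cancel] at e4
      rw [hy i]
      linarith
  have hiter : ∀ m : ℕ, G^[m] (u 0) ≤
      u m + ((∑ i ∈ Finset.range m, if a < y i then 1 else 0 : ℕ) : ℝ) := by
    intro m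
    induction m with
    | zero => simp
    | succ m ih =>
      rw [Function.iterate_succ_apply']
      refine (G.mono ih).trans ?_
      rw [G.map_add_nat, Finset.sum_range_succ]
      have := hstep m
      push_cast at this ⊢
      linarith
  have hun : u n = u 0 := by simp only [u, hper]
  have h1 := hiter n
  rw [hun, ← CircleDeg1Lift.coe_pow] at h1
  have h2 := (G ^ n).translationNumber_le_of_le_add_nat h1
  rw [CircleDeg1Lift.translationNumber_pow] at h2
  have hn' : (0 : ℝ) < n := by exact_mod_cast hn
  rw [hcast, le_div_iff₀ hn']
  linarith

end IsFold

/-! ## The pattern `γ_{p/q}` is a unimodal over-twist pattern -/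

theorem gammaPattern_isUnimodal (p q : ℕ) (hp : 0 < p) (hpq : 2 * p ≤ q) (hcop : p.Coprime q) :
    (gammaPattern p q hp hpq hcop).IsUnimodal := by
  refine ⟨⟨q - 2 * p, by change _ < q; omega⟩, ?_, ?_⟩
  · rintro ⟨i, hi⟩ h1 ⟨j, hj⟩ h2 hij
    change gammaFun p q i < gammaFun p q j
    change i < q at hi
    change j < q at hj
    change i ≤ q - 2 * p at h1
    change j ≤ q - 2 * p at h2
    change i < j at hij
    unfold gammaFun
    split_ifs <;> omega
  · rintro ⟨i, hi⟩ h1 ⟨j, hj⟩ h2 hij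
    change gammaFun p q j < gammaFun p q i
    change i < q at hi
    change j < q at hj
    change q - 2 * p ≤ i at h1
    change q - 2 * p ≤ j at h2
    change i < j at hij
    unfold gammaFun
    split_ifs <;> omega

theorem gammaPattern_overRotationNumber (p q : ℕ) (hp : 0 < p) (hpq : 2 * p ≤ q)
    (hcop : p.Coprime q) :
    (gammaPattern p q hp hpq hcop).overRotationNumber = (p : ℝ) / q := by
  have hlt : ∀ i : ℕ, ((q : ℝ) - p - 1 / 2 < i ↔ q ≤ i + p) := by
    intro i
    constructor
    · intro h
      by_contra! hc
      have : ((i + p + 1 : ℕ) : ℝ) ≤ q := by exact_mod_cast hc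
      push_cast at this
      linarith
    · intro h
      have : (q : ℝ) ≤ ((i + p : ℕ) : ℝ) := by exact_mod_cast h
      push_cast at this
      linarith
  have hgt : ∀ i : ℕ, ((i : ℝ) < (q : ℝ) - p - 1 / 2 ↔ i + p < q) := by
    intro i
    constructor
    · intro h
      by_contra! hc
      have : (q : ℝ) ≤ ((i + p : ℕ) : ℝ) := by exact_mod_cast hc
      push_cast at this
      linarith
    · intro h
      have : ((i + p + 1 : ℕ) : ℝ) ≤ q := by exact_mod_cast h
      push_cast at this
      linarith
  -- The points up to `q - p - 1` move right and those from `q - p` on move left; the threshold is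
  -- halfway between.
  rw [Pattern.overRotationNumber_eq_of_sides (gammaPattern p q hp hpq hcop)
    (v := fun i => ((i : ℕ) : ℝ)) (fun i j hij => Nat.cast_lt.2 hij)
    (a := (q : ℝ) - p - 1 / 2)]
  · change (∑ i : Fin q, if (q : ℝ) - p - 1 / 2 < ((i : ℕ) : ℝ) then (1 : ℝ) else 0) / (q : ℝ) = _
    congr 1
    simp only [hlt]
    rw [Fin.sum_univ_eq_sum_range (fun i => if q ≤ i + p then (1 : ℝ) else 0) q, Finset.sum_boole]
    congr 1
    have : Finset.filter (fun i => q ≤ i + p) (Finset.range q) = Finset.Ico (q - p) q := by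
      ext i
      simp only [Finset.mem_filter, Finset.mem_range, Finset.mem_Ico]
      omega
    rw [this, Nat.card_Ico]
    omega
  · intro i hi
    rcases lt_or_ge ((i : ℕ) + p) q with h | h
    · exact ((hgt _).2 h).ne hi
    · exact ((hlt _).2 h).ne' hi
  · rintro ⟨i, hi⟩ h
    replace h := (hgt _).1 h
    change (i : ℝ) < (gammaFun p q i : ℝ)
    have : i < gammaFun p q i := by
      change i < q at hi
      simp only at h
      unfold gammaFun
      split_ifs <;> omega
    exact_mod_cast this
  · rintro ⟨i, hi⟩ h
    replace h := (hlt _).1 h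
    refine (hgt _).2 ?_
    change gammaFun p q i + p < q
    change i < q at hi
    simp only at h
    unfold gammaFun
    split_ifs <;> omega

/-- Two patterns exhibited by the same map on cycles with a common point are equal. -/
theorem Pattern.eq_of_common_point {g : ℝ → ℝ} {π θ : Pattern} {e : Fin π.n → ℝ}
    {v : Fin θ.n → ℝ} (he : StrictMono e) (hv : StrictMono v) (hge : ∀ i, g (e i) = e (π.perm i))
    (hgv : ∀ i, g (v i) = v (θ.perm i)) {i₀ : Fin π.n} {j₀ : Fin θ.n} (h : e i₀ = v j₀) :
    π = θ := by
  have hn : π.n = θ.n := by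
    rw [← Pattern.minimalPeriod_eq he.injective hge i₀, h,
      Pattern.minimalPeriod_eq hv.injective hgv j₀]
  have hsub : ∀ {π θ : Pattern} {e : Fin π.n → ℝ} {v : Fin θ.n → ℝ},
      (∀ i, g (e i) = e (π.perm i)) → (∀ i, g (v i) = v (θ.perm i)) →
      ∀ {i₀ : Fin π.n} {j₀ : Fin θ.n}, e i₀ = v j₀ → Set.range e ⊆ Set.range v := by
    rintro π θ e v hge hgv i₀ j₀ h _ ⟨i, rfl⟩
    have hc : π.perm.IsCycleOn ((Finset.univ : Finset (Fin π.n)) : Set (Fin π.n)) := by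
      simpa using π.cyclic
    obtain ⟨k, -, hki⟩ := hc.exists_pow_eq (Finset.mem_univ i₀) (Finset.mem_univ i)
    rw [← hki, ← Pattern.iterate_apply hge, h, Pattern.iterate_apply hgv]
    exact Set.mem_range_self _
  have hrange : Set.range e = Set.range v := (hsub hge hgv h).antisymm (hsub hgv hge h.symm)
  obtain ⟨n, hpos, σ, hσ⟩ := π
  obtain ⟨m, hpos', τ, hτ⟩ := θ
  simp only at hn
  subst hn
  have hev : e = v := (he.range_inj hv).1 hrange
  subst hev
  have : σ = τ := Equiv.ext fun i => he.injective ((hge i).symm.trans (hgv i))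
  subst this
  rfl

/-- A piecewise linear map exhibiting `γ_{p/q}` on `0, …, q - 1`, which moves all other points
around the circle by at least `p`. -/
noncomputable def twistMap (p q x : ℝ) : ℝ :=
  if x ≤ q - p - 1 then
    min (max (x + p) (p * (x - (q - 2 * p - 1)) + (q - p - 1))) (2 * q - 2 * p - 1 - x)
  else max (q - p - (q - 2 * p + 1) * (x - (q - p - 1))) (q - 1 - x)

/-! ### Displacement estimates for the twist map and the rigidity of its cycles -/

section TwistMap

variable {p q x : ℝ}

theorem continuous_twistMap (hp : 1 ≤ p) (hpq : 2 * p ≤ q) : Continuous (twistMap p q) := by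
  unfold twistMap
  refine Continuous.if_le (by fun_prop) (by fun_prop) continuous_id continuous_const ?_
  rintro x rfl
  rw [min_eq_right, max_eq_left]
  · ring
  · linarith
  · exact le_max_of_le_left (by linarith)

theorem twistMap_mem (hp : 1 ≤ p) (hpq : 2 * p ≤ q) (h0 : 0 ≤ x) (h1 : x ≤ q - 1) :
    0 ≤ twistMap p q x ∧ twistMap p q x ≤ q - 1 := by
  unfold twistMap
  split_ifs with h
  · refine ⟨le_min (le_max_of_le_left (by linarith)) (by linarith), ?_⟩
    rcases le_or_gt x (q - 2 * p) with h2 | h2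
    · exact (min_le_left _ _).trans (max_le (by linarith) (by nlinarith))
    · exact (min_le_right _ _).trans (by linarith)
  · refine ⟨le_max_of_le_right (by linarith), max_le ?_ (by linarith)⟩
    have := mul_nonneg (by linarith : 0 ≤ q - 2 * p + 1) (by linarith : 0 ≤ x - (q - p - 1))
    linarith

theorem twistMap_natCast {p q j : ℕ} (hp : 0 < p) (hpq : 2 * p ≤ q) (hj : j < q) :
    twistMap p q j = gammaFun p q j := by
  have hp' : (1 : ℝ) ≤ p := by exact_mod_cast hp
  have hpq' : (2 : ℝ) * p ≤ q := by exact_mod_cast hpq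
  have hj' : (j : ℝ) + 1 ≤ q := by exact_mod_cast hj
  unfold twistMap gammaFun
  by_cases h2 : j + p < q
  · have h2' : (j : ℝ) + p + 1 ≤ q := by exact_mod_cast h2
    rw [if_pos (by linarith)]
    split_ifs with h1
    · have h1' : (j : ℝ) + 2 * p + 1 ≤ q := by exact_mod_cast h1
      rw [max_eq_left, min_eq_left]
      · push_cast
        ring
      · linarith
      · nlinarith
    · have h1' : (q : ℝ) ≤ j + 2 * p := by exact_mod_cast (not_lt.1 h1)
      rw [min_eq_right]
      · rw [Nat.cast_sub (by omega), Nat.cast_sub (by omega), Nat.cast_sub (by omega)]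
        push_cast
        ring
      · exact le_max_of_le_right (by nlinarith)
  · have h2' : (q : ℝ) ≤ j + p := by exact_mod_cast (not_lt.1 h2)
    rw [if_neg (by linarith), if_neg (by omega), if_neg h2, max_eq_right]
    · rw [Nat.cast_sub (by omega), Nat.cast_sub (by omega)]
      push_cast
      ring
    · nlinarith

variable {a : ℝ}

/-- The equation for `a` is the fixed point equation on the steep piece of slope `-(q - 2p + 1)`
that starts at `q - p - 1`. -/
theorem twistMap_fix (hpq : 2 * p ≤ q)
    (ha : (q - 2 * p + 2) * (a - (q - p - 1)) = 1) : q - p - 1 < a ∧ a < q - p ∧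
      twistMap p q a = a := by
  have h1 : 0 < a - (q - p - 1) := by
    by_contra! hc
    nlinarith
  have h2 : a - (q - p - 1) < 1 := by
    by_contra! hc
    nlinarith
  refine ⟨by linarith, by linarith, ?_⟩
  unfold twistMap
  rw [if_neg (by linarith), max_eq_left] <;> nlinarith

/-- The last two bounds say that the point advances by at least `p` in the coordinate where `x > a`
is replaced by `2q - p - 1 - x`: one applies if the image stays to the left of `a`, the other if it
crosses. -/
theorem twistMap_left (hp : 1 ≤ p) (hpq : 2 * p ≤ q)
    (ha : (q - 2 * p + 2) * (a - (q - p - 1)) = 1) (hx : x < a) :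
    x < twistMap p q x ∧ (twistMap p q x < a → x + p ≤ twistMap p q x) ∧
      twistMap p q x ≤ 2 * q - 2 * p - 1 - x := by
  obtain ⟨ha1, ha2, -⟩ := twistMap_fix hpq ha
  unfold twistMap
  split_ifs with h
  · refine ⟨lt_min (lt_max_of_lt_left (by linarith)) (by linarith), fun h1 => ?_, min_le_right _ _⟩
    rcases min_lt_iff.1 h1 with h2 | h2
    · refine le_min (le_max_left _ _) ?_
      have := (le_max_left _ _).trans h2.le
      linarith
    · linarith
  · have e1 : a < q - p - (q - 2 * p + 1) * (x - (q - p - 1)) := by nlinarith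
    refine ⟨lt_max_of_lt_left (by linarith), fun h1 => ?_, max_le ?_ (by linarith)⟩
    · exact absurd (e1.trans_le (le_max_left _ _)) h1.not_gt
    · nlinarith

theorem twistMap_right (hpq : 2 * p ≤ q)
    (ha : (q - 2 * p + 2) * (a - (q - p - 1)) = 1) (hx : a < x) :
    twistMap p q x < a ∧ q - 1 - x ≤ twistMap p q x := by
  obtain ⟨ha1, ha2, -⟩ := twistMap_fix hpq ha
  unfold twistMap
  rw [if_neg (by linarith)]
  refine ⟨max_lt (by nlinarith) ?_, le_max_right _ _⟩
  nlinarith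

/-- A cycle of the twist map of over-rotation number `p/q` has a point in common with a cycle of
pattern `γ_{p/q}`. -/
theorem exists_gamma_of_twistMap {p q : ℕ} (hp : 0 < p) (hpq : 2 * p ≤ q) (hcop : p.Coprime q)
    {θ : Pattern} (hθ : 2 ≤ θ.n) (hrot : θ.overRotationNumber = (p : ℝ) / q) {v : Fin θ.n → ℝ}
    (hv : StrictMono v) (hmem : ∀ i, 0 ≤ v i ∧ v i ≤ q - 1)
    (hmap : ∀ i, twistMap p q (v i) = v (θ.perm i)) :
    θ = gammaPattern p q hp hpq hcop := by
  have hp' : (1 : ℝ) ≤ p := by exact_mod_cast hp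
  have hpq' : (2 : ℝ) * p ≤ q := by exact_mod_cast hpq
  have hq' : (0 : ℝ) < q := by linarith
  have hn' : (0 : ℝ) < θ.n := by exact_mod_cast θ.pos
  obtain ⟨a, ha⟩ : ∃ a : ℝ, ((q : ℝ) - 2 * p + 2) * (a - (q - p - 1)) = 1 := by
    have : (q : ℝ) - 2 * p + 2 ≠ 0 := by linarith
    exact ⟨q - p - 1 + 1 / (q - 2 * p + 2), by field_simp; ring⟩
  obtain ⟨ha1, ha2, hafix⟩ := twistMap_fix hpq' ha
  have hne : ∀ i, v i ≠ a := by
    intro i hi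
    have := hmap i
    rw [hi, hafix, ← hi] at this
    exact θ.perm_ne hθ i (hv.injective this.symm)
  have hl : ∀ i, v i < a → v i < v (θ.perm i) := fun i hi =>
    hmap i ▸ (twistMap_left hp' hpq' ha hi).1
  have hr : ∀ i, a < v i → v (θ.perm i) < a := fun i hi =>
    hmap i ▸ (twistMap_right hpq' ha hi).1
  have hsum := θ.overRotationNumber_eq_of_sides hv hne hl hr
  rw [hrot, div_eq_div_iff hq'.ne' hn'.ne'] at hsum
  let φ : Fin θ.n → ℝ := fun i => if a < v i then 2 * q - p - 1 - v i else v i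
  have hφl : ∀ i, v i < a → φ i = v i := fun i hi => if_neg hi.not_gt
  have hφr : ∀ i, a < v i → φ i = 2 * q - p - 1 - v i := fun i hi => if_pos hi
  have hφmem : ∀ i, 0 ≤ φ i ∧ φ i < q := by
    intro i
    have := hmem i
    rcases (hne i).lt_or_gt with h | h
    · rw [hφl i h]
      constructor <;> linarith
    · rw [hφr i h]
      constructor <;> linarith
  have hside : ∀ i, (φ i < q - p ∧ φ i = v i ∧ v i < a) ∨
      ((q : ℝ) - p ≤ φ i ∧ v i = 2 * q - p - 1 - φ i ∧ a < v i) := by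
    intro i
    have := hmem i
    rcases (hne i).lt_or_gt with h | h
    · rw [hφl i h]
      exact Or.inl ⟨by linarith, rfl, h⟩
    · rw [hφr i h]
      exact Or.inr ⟨by linarith, by ring, h⟩
  -- Advance by at least `p` on a circle of length `q`, a turn being completed at each point to the
  -- right of `a`.
  have hle : ∀ i, (p : ℝ) ≤ φ (θ.perm i) - φ i + q * (if a < v i then (1 : ℝ) else 0) := by
    intro i
    rcases (hne i).lt_or_gt with h | h
    · rw [if_neg h.not_gt, hφl i h]
      obtain ⟨-, e2, e3⟩ := twistMap_left hp' hpq' ha h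
      rw [hmap] at e2 e3
      rcases (hne (θ.perm i)).lt_or_gt with h2 | h2
      · rw [hφl _ h2]
        linarith [e2 h2]
      · rw [hφr _ h2]
        linarith
    · rw [if_pos h, hφr i h]
      obtain ⟨e1, e2⟩ := twistMap_right hpq' ha h
      rw [hmap] at e1 e2
      rw [hφl _ e1]
      linarith
  -- The differences of `φ` cancel over the cycle and the over-rotation number fixes the number of
  -- turns, so both sides of `hle` have equal sums.
  have heq : ∀ i, (p : ℝ) = φ (θ.perm i) - φ i + q * (if a < v i then (1 : ℝ) else 0) := by
    have h1 : ∑ _i : Fin θ.n, (p : ℝ) =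
        ∑ i, (φ (θ.perm i) - φ i + q * (if a < v i then (1 : ℝ) else 0)) := by
      rw [Finset.sum_add_distrib, Finset.sum_sub_distrib, Equiv.sum_comp θ.perm φ,
        ← Finset.mul_sum]
      simp only [Finset.sum_const, Finset.card_univ, Fintype.card_fin, nsmul_eq_mul]
      linarith
    intro i
    exact (Finset.sum_eq_sum_iff_of_le fun i _ => hle i).1 h1 i (Finset.mem_univ i)
  have hstep : ∀ i, (φ i < q - p ∧ φ (θ.perm i) = φ i + p) ∨
      ((q : ℝ) - p ≤ φ i ∧ φ (θ.perm i) = φ i + p - q) := by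
    intro i
    have h1 := heq i
    rcases hside i with ⟨h2, -, h3⟩ | ⟨h2, -, h3⟩
    · rw [if_neg h3.not_gt] at h1
      exact Or.inl ⟨h2, by linarith⟩
    · rw [if_pos h3] at h1
      exact Or.inr ⟨h2, by linarith⟩
  let i₀ : Fin θ.n := ⟨0, θ.pos⟩
  set s : ℝ := Int.fract (φ i₀) with hs
  have hs0 : 0 ≤ s := Int.fract_nonneg _
  have hs1 : s < 1 := Int.fract_lt_one _
  have hpos : ∀ k : ℕ, ∃ m : ℤ, φ ((θ.perm ^ k) i₀) = s + (⌊φ i₀⌋ + k * p - m * q : ℤ) := by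
    intro k
    induction k with
    | zero =>
      refine ⟨0, ?_⟩
      have := Int.floor_add_fract (φ i₀)
      simp
      linarith
    | succ k ih =>
      obtain ⟨m, hm⟩ := ih
      rw [pow_succ', Equiv.Perm.mul_apply]
      rcases hstep ((θ.perm ^ k) i₀) with ⟨-, h⟩ | ⟨-, h⟩
      · refine ⟨m, ?_⟩
        rw [h, hm]
        push_cast
        ring
      · refine ⟨m + 1, ?_⟩
        rw [h, hm]
        push_cast
        ring
  -- Steps of `p` modulo `q` reach every residue, as `p` and `q` are coprime; the bounds on `φ` then
  -- fix the multiple of `q`.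
  have hall : ∀ N : ℕ, N < q → ∃ i, φ i = s + N := by
    intro N hN
    obtain ⟨u, w, huw⟩ := Nat.isCoprime_iff_coprime.2 hcop
    have hqz : (0 : ℤ) < q := by exact_mod_cast (by omega : 0 < q)
    set d : ℤ := (N - ⌊φ i₀⌋) with hd
    obtain ⟨m, hm⟩ := hpos ((d * u) % q).toNat
    rw [Int.toNat_of_nonneg (Int.emod_nonneg _ hqz.ne')] at hm
    set i := (θ.perm ^ ((d * u) % q).toNat) i₀
    have hdiv := Int.emod_add_mul_ediv (d * u) q
    obtain ⟨r, hr⟩ : ∃ r : ℤ, ⌊φ i₀⌋ + (d * u) % q * p - m * q = N + r * q := by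
      refine ⟨-(d * w) - (d * u) / q * p - m, ?_⟩
      linear_combination p * hdiv + d * huw + hd
    rw [hr] at hm
    have hr0 : r = 0 := by
      obtain ⟨e1, e2⟩ := hφmem i
      rw [hm] at e1 e2
      have e3 : (-1 : ℝ) < ((N + r * q : ℤ) : ℝ) := by linarith
      have e4 : ((N + r * q : ℤ) : ℝ) < ((q : ℤ) : ℝ) := by push_cast at e2 ⊢; linarith
      have e3' : -1 < (N + r * q : ℤ) := by exact_mod_cast e3
      have e4' : (N + r * q : ℤ) < q := by exact_mod_cast e4
      have hNz : (N : ℤ) < q := by exact_mod_cast hN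
      by_contra hr
      rcases lt_or_gt_of_ne hr with h | h
      · nlinarith
      · nlinarith
    refine ⟨i, ?_⟩
    rw [hm, hr0]
    push_cast
    ring
  have hleft : ∀ N : ℕ, N + p < q → ∃ i, φ i = s + N ∧ v i = s + N ∧ v i < a := by
    intro N hN
    obtain ⟨i, hi⟩ := hall N (by omega)
    have hN' : (N : ℝ) + p + 1 ≤ q := by exact_mod_cast hN
    rcases hside i with ⟨-, h2, h3⟩ | ⟨h1, -, -⟩
    · exact ⟨i, hi, by linarith, h3⟩
    · linarith
  have hright : ∀ N : ℕ, q ≤ N + p → N < q →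
      ∃ i, φ i = s + N ∧ v i = 2 * q - p - 1 - (s + N) ∧ a < v i := by
    intro N hN hNq
    obtain ⟨i, hi⟩ := hall N hNq
    have hN' : (q : ℝ) ≤ N + p := by exact_mod_cast hN
    rcases hside i with ⟨h1, -, -⟩ | ⟨-, h2, h3⟩
    · linarith
    · exact ⟨i, hi, by rw [h2, hi], h3⟩
  obtain ⟨e, he, hfe, hval⟩ := exists_gamma_of_rotation (f := twistMap p q) hp hpq (a := a)
    (κ := 2 * q - p - 1) (Z := fun N : ℕ => s + N)
    (fun M N hMN _ => by
      have : (M : ℝ) < N := by exact_mod_cast hMN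
      simpa using this)
    (fun N hN => by
      obtain ⟨i, -, h2, h3⟩ := hleft N hN
      exact h2 ▸ h3)
    (fun N hN hNq => by
      obtain ⟨i, -, h2, h3⟩ := hright N hN hNq
      exact h2 ▸ h3)
    (fun N hN => by
      obtain ⟨i, h1, h2, h3⟩ := hleft N (by omega)
      have hN' : (N : ℝ) + 2 * p + 1 ≤ q := by exact_mod_cast hN
      rw [← h2, hmap]
      rcases hstep i with ⟨-, h4⟩ | ⟨h4, -⟩
      · rcases hside (θ.perm i) with ⟨-, h5, -⟩ | ⟨h5, -, -⟩
        · rw [← h5, h4, h1]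
          push_cast
          ring
        · linarith
      · linarith)
    (fun N hN hNq => by
      obtain ⟨i, h1, h2, h3⟩ := hleft N hNq
      have hN' : (q : ℝ) ≤ N + 2 * p := by exact_mod_cast hN
      have hNq' : (N : ℝ) + p + 1 ≤ q := by exact_mod_cast hNq
      rw [← h2, hmap]
      rcases hstep i with ⟨-, h4⟩ | ⟨h4, -⟩
      · rcases hside (θ.perm i) with ⟨h5, -, -⟩ | ⟨-, h5, -⟩
        · linarith
        · rw [h5, h4, h1]
          push_cast
          ring
      · linarith)
    (fun N hN hNq => by
      obtain ⟨i, h1, h2, h3⟩ := hright N hN hNq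
      have hN' : (q : ℝ) ≤ N + p := by exact_mod_cast hN
      have hNq' : (N : ℝ) + 1 ≤ q := by exact_mod_cast hNq
      rw [← h2, hmap]
      rcases hstep i with ⟨h4, -⟩ | ⟨-, h4⟩
      · linarith
      · rcases hside (θ.perm i) with ⟨-, h5, -⟩ | ⟨h5, -, -⟩
        · rw [← h5, h4, h1, Nat.cast_sub hN]
          push_cast
          ring
        · linarith)
  have hcommon : ∃ i, e ⟨0, by omega⟩ = v i := by
    rcases hval ⟨0, by omega⟩ with ⟨N, hN, h1⟩ | ⟨N, hN, hN', h1⟩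
    · obtain ⟨i, -, h2, -⟩ := hleft N hN
      exact ⟨i, h1.trans h2.symm⟩
    · obtain ⟨i, -, h2, -⟩ := hright N hN hN'
      exact ⟨i, h1.trans h2.symm⟩
  obtain ⟨i, hi⟩ := hcommon
  exact (Pattern.eq_of_common_point (π := gammaPattern p q hp hpq hcop) he hv hfe hmap hi).symm

end TwistMap

/-- One map suffices: the twist map, rescaled from `[0, q - 1]` to `[0, 1]`. -/
theorem gammaPattern_isOverTwist (p q : ℕ) (hp : 0 < p) (hpq : 2 * p ≤ q) (hcop : p.Coprime q) :
    (gammaPattern p q hp hpq hcop).IsOverTwist := by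
  refine ⟨by change 2 ≤ q; omega, fun θ hθ hrot hforce => ?_⟩
  have hp' : (1 : ℝ) ≤ p := by exact_mod_cast hp
  have hpq' : (2 : ℝ) * p ≤ q := by exact_mod_cast hpq
  have hq : (0 : ℝ) < q - 1 := by linarith
  have hscale : ∀ x : unitInterval, 0 ≤ ((q : ℝ) - 1) * x ∧ ((q : ℝ) - 1) * x ≤ q - 1 := fun x =>
    ⟨mul_nonneg hq.le x.2.1, mul_le_of_le_one_right hq.le x.2.2⟩
  have hmem : ∀ x : unitInterval, twistMap p q ((q - 1) * x) / (q - 1) ∈ unitInterval := by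
    intro x
    obtain ⟨h1, h2⟩ := twistMap_mem hp' hpq' (hscale x).1 (hscale x).2
    exact ⟨div_nonneg h1 hq.le, (div_le_one hq).2 h2⟩
  let f : unitInterval → unitInterval := fun x => ⟨_, hmem x⟩
  have hf : Continuous f := by
    have := continuous_twistMap hp' hpq'
    exact Continuous.subtype_mk (by fun_prop) _
  have hγ : Exhibits f (gammaPattern p q hp hpq hcop) := by
    have hj : ∀ j : Fin q, ((j : ℕ) : ℝ) / (q - 1) ∈ unitInterval := by
      intro j
      have : ((j : ℕ) : ℝ) + 1 ≤ q := by exact_mod_cast j.2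
      exact ⟨div_nonneg (Nat.cast_nonneg _) hq.le, (div_le_one hq).2 (by linarith)⟩
    refine ⟨fun j => ⟨_, hj j⟩, fun i j hij => ?_, fun j => Subtype.ext ?_⟩
    · have : ((i : ℕ) : ℝ) < (j : ℕ) := by exact_mod_cast hij
      exact Subtype.mk_lt_mk.2 (div_lt_div_of_pos_right this hq)
    · change twistMap p q ((q - 1) * (((j : ℕ) : ℝ) / (q - 1))) / (q - 1) =
        ((gammaFun p q j : ℕ) : ℝ) / (q - 1)
      rw [mul_div_cancel₀ _ hq.ne', twistMap_natCast hp hpq j.2]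
  obtain ⟨e, he, hfe⟩ := hforce f hf hγ
  refine exists_gamma_of_twistMap hp hpq hcop hθ
    (hrot.trans (gammaPattern_overRotationNumber p q hp hpq hcop))
    (v := fun i => ((q : ℝ) - 1) * e i) (fun i j hij => ?_) (fun i => hscale _) fun i => ?_
  · exact mul_lt_mul_of_pos_left (he hij) hq
  · have h1 := congrArg (fun x : unitInterval => (x : ℝ)) (hfe i)
    change twistMap p q ((q - 1) * e i) / (q - 1) = e (θ.perm i) at h1
    rw [← h1, mul_div_cancel₀ _ hq.ne']

/-! ## Cycles of maps of the unit interval -/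

/-- The extension of a self-map of `[0,1]` to the line by constants. -/
noncomputable def extendReal (f : unitInterval → unitInterval) (x : ℝ) : ℝ :=
  f (Set.projIcc 0 1 zero_le_one x)

theorem continuous_extendReal {f : unitInterval → unitInterval} (hf : Continuous f) :
    Continuous (extendReal f) :=
  continuous_subtype_val.comp (hf.comp continuous_projIcc)

theorem extendReal_coe (f : unitInterval → unitInterval) (x : unitInterval) :
    extendReal f x = f x := by
  unfold extendReal
  rw [Set.projIcc_val]

theorem extendReal_mem (f : unitInterval → unitInterval) (x : ℝ) :
    extendReal f x ∈ Set.Icc (0 : ℝ) 1 := (f _).2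

theorem exhibits_of_extendReal {f : unitInterval → unitInterval} {π : Pattern} {e : Fin π.n → ℝ}
    (he : StrictMono e) (hmem : ∀ i, e i ∈ Set.Icc (0 : ℝ) 1)
    (hf : ∀ i, extendReal f (e i) = e (π.perm i)) : Exhibits f π := by
  refine ⟨fun i => ⟨e i, hmem i⟩, fun i j hij => he hij, fun i => Subtype.ext ?_⟩
  rw [← extendReal_coe]
  exact hf i

/-- A turning point mapped across a fixed point yields a cycle of period two. -/
theorem exists_two_cycle {f : ℝ → ℝ} (hf : Continuous f) {α c a : ℝ} (hαc : α ≤ c) (hca : c < a)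
    (hfix : f a = a) (htop : a < f c) (hbot : f (f c) ≤ c) (hα : α ≤ f (f α)) :
    ∃ x y : ℝ, α ≤ x ∧ x < y ∧ f x = y ∧ f y = x := by
  -- `d` is the last point of `[α, c]` with `f d ≤ a`, where in fact `f d = a = f (f d)`, or `α` if
  -- there is none. Then `f ∘ f - id` changes sign on `[d, c]`, where `f ≥ a` rules out a fixed
  -- point.
  obtain ⟨d, hαd, hdc, hd, hda⟩ : ∃ d, α ≤ d ∧ d ≤ c ∧ d ≤ f (f d) ∧
      ∀ x ∈ Set.Icc d c, a ≤ f x := by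
    by_cases hex : ∃ x ∈ Set.Icc α c, f x ≤ a
    · have hcomp : IsCompact (Set.Icc α c ∩ {x | f x ≤ a}) :=
        isCompact_Icc.inter_right (isClosed_le hf continuous_const)
      obtain ⟨d, ⟨hd, hda⟩, hmax⟩ := hcomp.exists_isGreatest hex
      have hval : ∀ x, d < x → x ≤ c → a < f x := by
        intro x hx hxc
        by_contra! hcon
        exact hx.not_ge (hmax ⟨⟨hd.1.trans hx.le, hxc⟩, hcon⟩)
      obtain ⟨z, hz, hza⟩ := intermediate_value_Icc hd.2 hf.continuousOn
        (show a ∈ Set.Icc (f d) (f c) from ⟨hda, htop.le⟩)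
      have hzd : z = d := le_antisymm (hmax ⟨⟨hd.1.trans hz.1, hz.2⟩, hza.le⟩) hz.1
      rw [hzd] at hza
      refine ⟨d, hd.1, hd.2, ?_, fun x hx => ?_⟩
      · rw [hza, hfix]
        exact hd.2.trans hca.le
      · rcases hx.1.eq_or_lt with rfl | h
        · exact hza.ge
        · exact (hval x h hx.2).le
    · push Not at hex
      exact ⟨α, le_rfl, hαc, hα, fun x hx => (hex x hx).le⟩
  have hcont : ContinuousOn (fun x => f (f x) - x) (Set.Icc d c) := by fun_prop
  obtain ⟨x, hx, hx0⟩ := intermediate_value_Icc' hdc hcont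
    (show (0 : ℝ) ∈ Set.Icc (f (f c) - c) (f (f d) - d) from
      ⟨sub_nonpos.2 hbot, sub_nonneg.2 hd⟩)
  exact ⟨x, f x, hαd.trans hx.1, (hx.2.trans_lt hca).trans_le (hda x hx), rfl,
    sub_eq_zero.1 hx0⟩

theorem exhibits_gamma_half {f : unitInterval → unitInterval} (hp : 0 < 1) (hpq : 2 * 1 ≤ 2)
    (hcop : Nat.Coprime 1 2) {x y : ℝ} (hx : 0 ≤ x) (hxy : x < y) (hfx : extendReal f x = y)
    (hfy : extendReal f y = x) : Exhibits f (gammaPattern 1 2 hp hpq hcop) := by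
  have hy1 : y ≤ 1 := hfx ▸ (extendReal_mem f x).2
  refine exhibits_of_extendReal (π := gammaPattern 1 2 hp hpq hcop)
    (e := fun i : Fin 2 => if (i : ℕ) = 0 then x else y) ?_ ?_ ?_
  · rintro ⟨i, hi⟩ ⟨j, hj⟩ hij
    change i < 2 at hi
    change j < 2 at hj
    change i < j at hij
    change (if i = 0 then x else y) < if j = 0 then x else y
    rw [if_pos (by omega), if_neg (by omega)]
    exact hxy
  · rintro ⟨i, hi⟩
    change (if i = 0 then x else y) ∈ Set.Icc (0 : ℝ) 1
    split_ifs
    · exact ⟨hx, hxy.le.trans hy1⟩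
    · exact ⟨hx.trans hxy.le, hy1⟩
  · rintro ⟨i, hi⟩
    change i < 2 at hi
    change extendReal f (if i = 0 then x else y) = if gammaFun 1 2 i = 0 then x else y
    interval_cases i
    · simpa [gammaFun] using hfx
    · simpa [gammaFun] using hfy

theorem eq_one_of_two_mul_eq {p q : ℕ} (hcop : p.Coprime q) (h : q = 2 * p) : p = 1 ∧ q = 2 := by
  have hp : p = 1 := Nat.Coprime.eq_one_of_dvd hcop (h ▸ Dvd.intro_left 2 rfl)
  omega

/-! ## Unimodal patterns -/

namespace Pattern

/-- The shape of a unimodal pattern: it has a turning point `m` and a threshold `k > m`. Points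
below `k` move to the right, those between `m` and `k` go beyond `k`, and the points from `k`
on go below `k`. -/
theorem IsUnimodal.exists_threshold {π : Pattern} (hπ : π.IsUnimodal) (hn : 2 ≤ π.n) :
    ∃ m k l : Fin π.n, m ≤ k ∧ (l : ℕ) = k + 1 ∧ (π.perm m : ℕ) = π.n - 1 ∧
      (∀ i : Fin π.n, (i : ℕ) = π.n - 1 → (π.perm i : ℕ) = 0) ∧ (∀ i ≤ k, i < π.perm i) ∧
      (∀ i, m ≤ i → i ≤ k → l ≤ π.perm i) ∧ ∀ i, l ≤ i → π.perm i ≤ k := by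
  obtain ⟨m, hinc, hdec⟩ := hπ
  have hpos := π.pos
  have hne := π.perm_ne hn
  have hmax : ∀ i, π.perm i ≤ π.perm m := by
    intro i
    rcases le_total i m with h | h
    · exact hinc.monotoneOn h (Set.mem_Iic.2 le_rfl) h
    · exact hdec.antitoneOn (Set.mem_Ici.2 le_rfl) h h
  have hm : (π.perm m : ℕ) = π.n - 1 := by
    have h1 := hmax (π.perm.symm ⟨π.n - 1, by omega⟩)
    rw [Equiv.apply_symm_apply, Fin.le_def] at h1
    have := (π.perm m).2
    simp only at h1
    omega
  have hlast : ∀ i : Fin π.n, (i : ℕ) = π.n - 1 → (π.perm i : ℕ) = 0 := by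
    intro i hi
    set j := π.perm.symm ⟨0, hpos⟩ with hj
    have hj0 : (π.perm j : ℕ) = 0 := by rw [hj, Equiv.apply_symm_apply]
    have hji : j ≤ i := by rw [Fin.le_def]; omega
    rcases le_total j m with h | h
    · exfalso
      have h0 : (⟨0, hpos⟩ : Fin π.n) ≤ j := by rw [Fin.le_def]; exact Nat.zero_le _
      have h1 := hinc.monotoneOn (h0.trans h) h h0
      have h2 : π.perm ⟨0, hpos⟩ = ⟨0, hpos⟩ := by
        apply Fin.ext
        rw [Fin.le_def, hj0] at h1
        simp only
        omega
      exact hne _ h2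
    · have h1 := hdec.antitoneOn h (h.trans hji) hji
      rw [Fin.le_def, hj0] at h1
      omega
  -- If a point `i` of the increasing branch moved left, the points up to `i` would be mapped
  -- injectively into the points below `i`.
  have hleft : ∀ i ≤ m, i < π.perm i := by
    intro i hi
    by_contra! hc
    have hlt : π.perm i < i := lt_of_le_of_ne hc (hne i)
    have hmaps : ∀ j ∈ Finset.Iic i, π.perm j ∈ Finset.Iio i := by
      intro j hj
      rw [Finset.mem_Iic] at hj
      exact Finset.mem_Iio.2 ((hinc.monotoneOn (hj.trans hi) hi hj).trans_lt hlt)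
    have := Finset.card_le_card_of_injOn _ hmaps π.perm.injective.injOn
    rw [Fin.card_Iic, Fin.card_Iio] at this
    omega
  have hex : ∃ l : ℕ, ∃ h : l < π.n, π.perm ⟨l, h⟩ < ⟨l, h⟩ := by
    refine ⟨π.n - 1, by omega, ?_⟩
    rw [Fin.lt_def, hlast _ rfl]
    simp only
    omega
  classical
  -- `l` is the first point moving left and `k = l - 1`; monotonicity on the decreasing branch does
  -- the rest.
  obtain ⟨l, ⟨hl, hlt⟩, hfind⟩ : ∃ l : ℕ, (∃ h : l < π.n, π.perm ⟨l, h⟩ < ⟨l, h⟩) ∧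
      ∀ j < l, ¬∃ h : j < π.n, π.perm ⟨j, h⟩ < ⟨j, h⟩ :=
    ⟨Nat.find hex, Nat.find_spec hex, fun j hj => Nat.find_min hex hj⟩
  have hmin : ∀ i : Fin π.n, (i : ℕ) < l → i < π.perm i := by
    intro i hi
    have := hfind i hi
    push Not at this
    exact lt_of_le_of_ne (this i.2) (hne i).symm
  have hml : (m : ℕ) < l := by
    by_contra! hc
    exact absurd hlt (hleft ⟨l, hl⟩ hc).not_gt
  refine ⟨m, ⟨l - 1, by omega⟩, ⟨l, hl⟩, ?_, ?_, hm, hlast, ?_, ?_, ?_⟩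
  · rw [Fin.le_def]
    simp only
    omega
  · simp only
    omega
  · intro i hi
    rw [Fin.le_def] at hi
    simp only at hi
    exact hmin i (by omega)
  · intro i hmi hi
    have h1 := hdec.antitoneOn hmi (hmi.trans hi) hi
    have h2 := hmin ⟨l - 1, by omega⟩ (by simp only; omega)
    rw [Fin.le_def] at h1 ⊢
    rw [Fin.lt_def] at h2
    simp only at h1 h2 ⊢
    omega
  · intro i hi
    have hml' : m ≤ ⟨l, hl⟩ := by rw [Fin.le_def]; exact hml.le
    have h1 := hdec.antitoneOn hml' (hml'.trans hi) hi
    rw [Fin.le_def] at h1 ⊢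
    rw [Fin.lt_def] at hlt
    simp only at hlt ⊢
    omega

/-- A unimodal pattern of over-rotation number `p/q` forces `γ_{p/q}`. -/
theorem IsUnimodal.forces_gamma {π : Pattern} (hπ : π.IsUnimodal) (hn : 2 ≤ π.n) {p q : ℕ}
    (hp : 0 < p) (hpq : 2 * p ≤ q) (hcop : p.Coprime q)
    (hrot : π.overRotationNumber = (p : ℝ) / q) : π.Forces (gammaPattern p q hp hpq hcop) := by
  rintro f hcf ⟨e, he, hfe⟩
  obtain ⟨m, k, l, hmk, hkl, hm, hlast, hleft, hmid, hright⟩ := hπ.exists_threshold hn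
  set F := extendReal f with hF
  have hcF : Continuous F := continuous_extendReal hcf
  let v : Fin π.n → ℝ := fun i => e i
  have hv : StrictMono v := fun i j hij => he hij
  have hFv : ∀ i, F (v i) = v (π.perm i) := fun i => by
    rw [hF, extendReal_coe, hfe]
  have hk_lt : k < l := by rw [Fin.lt_def]; omega
  obtain ⟨a, ha, hfix⟩ : ∃ a ∈ Set.Icc (v k) (v l), F a = a := by
    obtain ⟨a, ha, ha0⟩ := intermediate_value_Icc' (hv hk_lt).le
      (f := fun x => F x - x) (by fun_prop)
      (show (0 : ℝ) ∈ _ from ⟨by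
        simp only [hFv, sub_nonpos]
        exact hv.monotone ((hright l le_rfl).trans hk_lt.le), by
        simp only [hFv, sub_nonneg]
        exact hv.monotone (hleft k le_rfl).le⟩)
    exact ⟨a, ha, sub_eq_zero.1 ha0⟩
  have hne : ∀ i, v i ≠ a := by
    intro i hi
    have := hFv i
    rw [hi, hfix, ← hi] at this
    exact π.perm_ne hn i (hv.injective this.symm)
  have hka : v k < a := lt_of_le_of_ne ha.1 (hne k)
  have hal : a < v l := lt_of_le_of_ne ha.2 (hne l).symm
  have hlk : ∀ i, v i < a → i ≤ k := by
    intro i hi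
    by_contra! hc
    have : l ≤ i := by rw [Fin.le_def]; rw [Fin.lt_def] at hc; omega
    exact absurd (hal.trans_le (hv.monotone this)) hi.not_gt
  have hlk' : ∀ i, a < v i → l ≤ i := by
    intro i hi
    by_contra! hc
    have : i ≤ k := by rw [Fin.le_def]; rw [Fin.lt_def] at hc; omega
    exact absurd ((hv.monotone this).trans_lt hka) hi.not_gt
  let i₀ : Fin π.n := ⟨0, π.pos⟩
  let i₁ : Fin π.n := ⟨π.n - 1, by have := π.pos; omega⟩
  have hm1 : π.perm m = i₁ := Fin.ext hm
  have h10 : π.perm i₁ = i₀ := Fin.ext (hlast i₁ rfl)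
  have hmin : ∀ i, v i₀ ≤ v i := fun i => hv.monotone (by
    rw [Fin.le_def]; exact Nat.zero_le _)
  have hmax : ∀ i, v i ≤ v i₁ := fun i => hv.monotone (by
    rw [Fin.le_def]; exact Nat.le_sub_one_of_lt i.2)
  have hma : v m < a := (hv.monotone hmk).trans_lt hka
  have ha1 : a < v i₁ := hal.trans_le (hmax l)
  -- The semistable orbit argument needs `p/q < 1/2`; for `1/2` a 2-cycle is found directly.
  rcases hpq.eq_or_lt with h2 | h2
  · obtain ⟨rfl, rfl⟩ := eq_one_of_two_mul_eq hcop h2.symm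
    obtain ⟨x, y, hx, hxy, hfx, hfy⟩ := exists_two_cycle hcF (hmin m) hma hfix
      (by rw [hFv, hm1]; exact ha1) (by rw [hFv, hFv, hm1, h10]; exact hmin m)
      (by rw [hFv, hFv]; exact hmin _)
    exact exhibits_gamma_half hp hpq hcop ((e i₀).2.1.trans hx) hxy hfx hfy
  set α := v i₀ with hα
  set δ := v i₁ - α with hδ
  have hδ0 : 0 < δ := by
    have := hmin m
    linarith
  -- Rescales the convex hull of the cycle to `[0, 1]`. The map `g` need not preserve `[0, 1]`,
  -- which a fold does not require.
  let g : ℝ → ℝ := fun s => (F (α + δ * s) - α) / δ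
  have hgv : ∀ x, g ((x - α) / δ) = (F x - α) / δ := by
    intro x
    simp only [g]
    rw [mul_div_cancel₀ _ hδ0.ne', add_sub_cancel]
  have hmono : ∀ {x y : ℝ}, x < y → (x - α) / δ < (y - α) / δ := fun h =>
    div_lt_div_of_pos_right (by linarith) hδ0
  have hmono_iff : ∀ {x y : ℝ}, (x - α) / δ < (y - α) / δ ↔ x < y := fun {x y} => by
    rw [div_lt_div_iff_of_pos_right hδ0, sub_lt_sub_iff_right]
  have h1δ : (v i₁ - α) / δ = 1 := div_self hδ0.ne'
  have hfold : IsFold g ((v m - α) / δ) ((a - α) / δ) := by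
    refine ⟨?_, ?_, hmono hma, ?_, ?_, ?_, ?_⟩
    · simp only [g]
      fun_prop
    · exact div_nonneg (sub_nonneg.2 (hmin m)) hδ0.le
    · rw [← h1δ]
      exact hmono ha1
    · rw [hgv, hfix]
    · rw [hgv, hFv, hm1, h1δ]
    · rw [← h1δ, hgv, hFv, h10]
      simp [hα]
  have hnum : π.overRotationNumber =
      (∑ i, if (a - α) / δ < (v i - α) / δ then (1 : ℝ) else 0) / π.n := by
    rw [π.overRotationNumber_eq_of_sides hv hne]
    · simp only [hmono_iff]
    · exact fun i hi => hv (hleft i (hlk i hi))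
    · exact fun i hi => (hv.monotone (hright i (hlk' i hi))).trans_lt hka
  have hτ : (hfold.lift le_rfl (IsFold.level_le _ _ _)).translationNumber ≤ (p : ℝ) / q := by
    rw [← hrot, hnum, ← π.sum_range_pow i₀]
    refine hfold.translationNumber_le_of_orbit (y := fun i => (v ((π.perm ^ i) i₀) - α) / δ)
      ?_ ?_ ?_ ?_ ?_ π.pos ?_
    · intro i
      rw [hgv, hFv, pow_succ', Equiv.Perm.mul_apply]
    · intro i
      refine ⟨div_nonneg (sub_nonneg.2 (hmin _)) hδ0.le, (div_le_one hδ0).2 ?_⟩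
      have := hmax ((π.perm ^ i) i₀)
      linarith
    · intro i hi
      rw [div_left_inj' hδ0.ne', sub_left_inj] at hi
      exact hne _ hi
    · intro i h1 h2
      rw [pow_succ', Equiv.Perm.mul_apply, hmono_iff]
      rw [← not_lt, hmono_iff, not_lt, hv.le_iff_le] at h1
      exact hal.trans_le (hv.monotone (hmid _ h1 (hlk _ (hmono_iff.1 h2))))
    · intro i h1
      rw [pow_succ', Equiv.Perm.mul_apply, hmono_iff]
      exact (hv.monotone (hright _ (hlk' _ (hmono_iff.1 h1)))).trans_lt hka
    · simp only [pow_n_apply, pow_zero, Equiv.Perm.one_apply]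
  obtain ⟨E, hE, hgE, hEmem⟩ := hfold.exists_gamma hp h2 hcop hτ
  refine exhibits_of_extendReal (π := gammaPattern p q hp hpq hcop) (e := fun i => α + δ * E i)
    (fun i j hij => ?_) (fun i => ?_) fun i => ?_
  · have := mul_lt_mul_of_pos_left (hE hij) hδ0
    simpa using this
  · obtain ⟨h0, h1⟩ := hEmem i
    have h3 := (e i₀).2.1
    have h4 := (e i₁).2.2
    have h5 : α + δ = v i₁ := by rw [hδ]; ring
    have h6 := mul_nonneg hδ0.le h0
    have h7 := mul_le_of_le_one_right hδ0.le h1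
    change 0 ≤ α at h3
    change v i₁ ≤ 1 at h4
    exact ⟨by linarith, by linarith⟩
  · have := hgE i
    simp only [g] at this
    rw [div_eq_iff hδ0.ne'] at this
    change F (α + δ * E i) = α + δ * E (gammaPerm p q hpq i)
    linarith

end Pattern

/-! ## Unimodal maps -/

theorem IsUnimodalMap.exists_fold {f : unitInterval → unitInterval} (hf : IsUnimodalMap f) :
    ∃ c a : ℝ, IsFold (extendReal f) c a ∧ StrictAntiOn (extendReal f) (Set.Icc c 1) ∧
      extendReal f c = 1 ∧ extendReal f 1 = 0 := by
  obtain ⟨hcont, c, hc0, hc1, hfc, hf1, -, hanti⟩ := hf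
  have hcF := continuous_extendReal hcont
  have hFc : extendReal f c = 1 := by rw [extendReal_coe, hfc]; rfl
  have hF1 : extendReal f 1 = 0 := by
    have := extendReal_coe f 1
    rw [hf1] at this
    exact this
  have hanti' : StrictAntiOn (extendReal f) (Set.Icc (c : ℝ) 1) := by
    rintro x ⟨hx, hx1⟩ y ⟨hy, hy1⟩ hxy
    have hx0 := c.2.1.trans hx
    have hy0 := c.2.1.trans hy
    have := hanti (a := ⟨x, hx0, hx1⟩) (b := ⟨y, hy0, hy1⟩) ⟨hx, hx1⟩ ⟨hy, hy1⟩ hxy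
    have e1 := extendReal_coe f ⟨x, hx0, hx1⟩
    have e2 := extendReal_coe f ⟨y, hy0, hy1⟩
    simp only at e1 e2
    rw [e1, e2]
    exact this
  have hc1' : (c : ℝ) < 1 := hc1
  obtain ⟨a, ha, ha0⟩ := intermediate_value_Icc' hc1'.le
    (f := fun x => extendReal f x - x) (by fun_prop)
    (show (0 : ℝ) ∈ _ from ⟨by simp only [hF1]; norm_num, by simp only [hFc]; linarith⟩)
  have hfix : extendReal f a = a := sub_eq_zero.1 ha0
  refine ⟨c, a, ⟨hcF, c.2.1, ?_, ?_, hfix, hFc.ge, hF1.le⟩, hanti', hFc, hF1⟩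
  · refine lt_of_le_of_ne ha.1 ?_
    rintro rfl
    linarith
  · refine lt_of_le_of_ne ha.2 ?_
    rintro rfl
    linarith

/-! ### Bounds on rotation numbers and the over-rotation interval of a unimodal map -/

namespace IsFold

variable {f : ℝ → ℝ} {c a : ℝ}

theorem translationNumber_nonneg (hf : IsFold f c a) :
    0 ≤ (hf.lift le_rfl (level_le f c a)).translationNumber := by
  have h : (0 : ℝ) + (0 : ℕ) ≤ hf.lift le_rfl (level_le f c a) 0 := by
    rw [hf.lift_apply, foldMap_of_mem le_rfl one_pos, hf.base_zero le_rfl (level_le f c a)]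
    simpa using hf.level_nonneg
  simpa using CircleDeg1Lift.le_translationNumber_of_add_nat_le _ h

/-- The circle map lies below `f` on `[0, c]`, so it does not advance the fixed point `z`. -/
theorem translationNumber_nonpos_of_fixed (hf : IsFold f c a) {z : ℝ} (h0 : 0 ≤ z) (hz : z ≤ c)
    (hfz : f z = z) : (hf.lift le_rfl (level_le f c a)).translationNumber ≤ 0 := by
  have h : hf.lift le_rfl (level_le f c a) z ≤ z + (0 : ℕ) := by
    rw [hf.lift_apply, foldMap_of_mem h0 (by linarith [hf.c_lt, hf.lt_one]), hf.base_of_le_c hz]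
    have := envelope_le_apply (lo := foldLevel f c a) (hi := a) hf.cont h0 hz (by
      rw [hfz]
      refine (min_le_right _ _).trans (max_le h0 ?_)
      exact (infAfter_le hf.cont le_rfl h0 hz).trans_eq hfz)
    simpa [hfz] using this
  simpa using CircleDeg1Lift.translationNumber_le_of_le_add_nat _ h

end IsFold

theorem overRotationNumber_nonneg (f : unitInterval → unitInterval) (y : unitInterval) :
    0 ≤ overRotationNumber f y :=
  div_nonneg (Finset.sum_nonneg fun _ _ => chi_nonneg _ _ _) (Nat.cast_nonneg _)

theorem overRotationNumber_le_half (f : unitInterval → unitInterval) (y : unitInterval) :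
    overRotationNumber f y ≤ 1 / 2 := by
  refine div_le_of_le_mul₀ (Nat.cast_nonneg _) (by norm_num) ?_
  refine (Finset.sum_le_card_nsmul _ _ (1 / 2) fun _ _ => chi_le_half _ _ _).trans_eq ?_
  rw [Finset.card_range, nsmul_eq_mul, mul_comm]

/-- The rotation number of the circle map of a unimodal map is a lower bound for its over-rotation
numbers. -/
theorem translationNumber_le_overRotationNumber {f : unitInterval → unitInterval} {c a : ℝ}
    (hf : IsFold (extendReal f) c a) (hanti : StrictAntiOn (extendReal f) (Set.Icc c 1))
    (htop : extendReal f c = 1) {y : unitInterval} (hy : y ∈ Function.periodicPts f)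
    (hfy : f y ≠ y) :
    (hf.lift le_rfl (IsFold.level_le _ c a)).translationNumber ≤ overRotationNumber f y := by
  have hca := hf.c_lt
  have ha1 := hf.lt_one
  have hcont := hf.cont
  -- A fixed point in `[0, c]` makes the bound trivial; without one, all points to the left of `a`
  -- move right and `χ` counts visits to the right side.
  by_cases hex : ∃ z, 0 ≤ z ∧ z ≤ c ∧ extendReal f z = z
  · obtain ⟨z, h0, hz, hfz⟩ := hex
    exact (hf.translationNumber_nonpos_of_fixed h0 hz hfz).trans (overRotationNumber_nonneg f y)
  push Not at hex
  have hleft : ∀ x, 0 ≤ x → x < a → x < extendReal f x := by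
    intro x h0 hxa
    rcases le_or_gt x c with hxc | hxc
    · by_contra! hcon
      obtain ⟨z, hz, hz0⟩ := intermediate_value_Icc hxc (f := fun x => extendReal f x - x)
        (by fun_prop) (show (0 : ℝ) ∈ _ from ⟨sub_nonpos.2 hcon, by simp only [htop]; linarith⟩)
      exact hex z (h0.trans hz.1) hz.2 (sub_eq_zero.1 hz0)
    · have := hanti ⟨hxc.le, by linarith⟩ ⟨hca.le, ha1.le⟩ hxa
      rw [hf.fix] at this
      linarith
  have hright : ∀ x, x ≤ 1 → a < x → extendReal f x < a := by
    intro x hx1 hax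
    have := hanti ⟨hca.le, ha1.le⟩ ⟨by linarith, hx1⟩ hax
    rwa [hf.fix] at this
  have hstep : ∀ i, ((f^[i + 1] y : unitInterval) : ℝ) = extendReal f (f^[i] y : unitInterval) :=
    fun i => by rw [extendReal_coe, Function.iterate_succ_apply']
  have hper := Function.isPeriodicPt_minimalPeriod f y
  have hpos := Function.minimalPeriod_pos_of_mem_periodicPts hy
  -- A periodic orbit that reaches a fixed point is that fixed point.
  have hne : ∀ i, ((f^[i] y : unitInterval) : ℝ) ≠ a := by
    intro i hi
    have h1 : f (f^[i] y) = f^[i] y := by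
      apply Subtype.ext
      rw [← extendReal_coe, hi, hf.fix]
    have h2 : f^[Function.minimalPeriod f y * i] y = y := (hper.mul_const i)
    have h3 : Function.minimalPeriod f y * i = (Function.minimalPeriod f y * i - i) + i :=
      (Nat.sub_add_cancel (Nat.le_mul_of_pos_left i hpos)).symm
    rw [h3, Function.iterate_add_apply, Function.iterate_fixed h1] at h2
    rw [h2] at h1
    exact hfy h1
  have hn : f^[Function.minimalPeriod f y] y = y := hper
  unfold overRotationNumber
  rw [sum_chi_iterate_eq_sum_right (a := a) hn hne
    (fun i hi => by rw [hstep]; exact hleft _ (f^[i] y).2.1 hi)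
    (fun i hi => by rw [hstep]; exact hright _ (f^[i] y).2.2 hi)]
  refine hf.translationNumber_le_of_orbit (y := fun i => ((f^[i] y : unitInterval) : ℝ))
    hstep (fun i => (f^[i] y).2) hne ?_ ?_ hpos (by simp only [hn, Function.iterate_zero, id])
  · intro i h1 h2
    have := hanti ⟨h1, (f^[i] y).2.2⟩ ⟨hca.le, ha1.le⟩ h2
    rw [hf.fix] at this
    rw [hstep]
    exact this
  · intro i hi
    rw [hstep]
    exact hright _ (f^[i] y).2.2 hi

theorem exhibits_gamma_of_translationNumber_le {f : unitInterval → unitInterval} {c a : ℝ}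
    (hf : IsFold (extendReal f) c a) (htop : extendReal f c = 1) (hbot : extendReal f 1 = 0)
    {p q : ℕ} (hp : 0 < p) (hpq : 2 * p ≤ q) (hcop : p.Coprime q)
    (h : (hf.lift le_rfl (IsFold.level_le _ c a)).translationNumber ≤ (p : ℝ) / q) :
    Exhibits f (gammaPattern p q hp hpq hcop) := by
  rcases hpq.eq_or_lt with h2 | h2
  · obtain ⟨rfl, rfl⟩ := eq_one_of_two_mul_eq hcop h2.symm
    obtain ⟨x, y, hx, hxy, hfx, hfy⟩ := exists_two_cycle hf.cont hf.c_nonneg hf.c_lt hf.fix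
      (by rw [htop]; exact hf.lt_one) (by rw [htop, hbot]; exact hf.c_nonneg)
      (extendReal_mem f _).1
    exact exhibits_gamma_half hp hpq hcop hx hxy hfx hfy
  · obtain ⟨e, he, hfe, hmem⟩ := hf.exists_gamma hp h2 hcop h
    exact exhibits_of_extendReal (π := gammaPattern p q hp hpq hcop) he hmem hfe

/-- The over-rotation interval of a unimodal map reaches from the rotation number of its circle map
to `1/2`. -/
theorem overRotationInterval_eq {f : unitInterval → unitInterval} {c a : ℝ}
    (hf : IsFold (extendReal f) c a) (hanti : StrictAntiOn (extendReal f) (Set.Icc c 1))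
    (htop : extendReal f c = 1) (hbot : extendReal f 1 = 0)
    (hhalf : (hf.lift le_rfl (IsFold.level_le _ c a)).translationNumber ≤ 1 / 2) :
    overRotationInterval f =
      Set.Icc (hf.lift le_rfl (IsFold.level_le _ c a)).translationNumber (1 / 2) := by
  have hrat : ∀ r : ℚ, (0 : ℝ) < r → (r : ℝ) ≤ 1 / 2 →
      (hf.lift le_rfl (IsFold.level_le _ c a)).translationNumber ≤ r →
      ∃ y : unitInterval, y ∈ Function.periodicPts f ∧ f y ≠ y ∧
        overRotationNumber f y = r := by
    intro r h0 h1 h2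
    have h0' : 0 < r := by exact_mod_cast h0
    have hnum : 0 < r.num := Rat.num_pos.2 h0'
    have hp : 0 < r.num.natAbs := Int.natAbs_pos.2 hnum.ne'
    have hcast : (r : ℝ) = (r.num.natAbs : ℝ) / r.den := by
      rw [Rat.cast_def, Nat.cast_natAbs, abs_of_pos hnum]
    have hq : (0 : ℝ) < r.den := by exact_mod_cast r.den_pos
    have hpq : 2 * r.num.natAbs ≤ r.den := by
      rw [hcast, div_le_div_iff₀ hq two_pos] at h1
      have : ((2 * r.num.natAbs : ℕ) : ℝ) ≤ r.den := by push_cast at h1 ⊢; linarith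
      exact_mod_cast this
    rw [hcast] at h2
    obtain ⟨y, hy, hfy, hrot⟩ := (exhibits_gamma_of_translationNumber_le hf htop hbot hp hpq
      r.reduced h2).exists_periodicPt (by change 2 ≤ r.den; omega)
    refine ⟨y, hy, hfy, ?_⟩
    rw [hrot, gammaPattern_overRotationNumber, hcast]
  refine (closure_minimal ?_ isClosed_Icc).antisymm ?_
  · rintro _ ⟨y, hy, hfy, rfl⟩
    exact ⟨translationNumber_le_overRotationNumber hf hanti htop hy hfy,
      overRotationNumber_le_half f y⟩
  · rintro x ⟨hx, hx2⟩
    rcases hx2.eq_or_lt with rfl | hlt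
    -- The endpoint `1/2` is attained, which also covers a degenerate interval.
    · refine subset_closure ?_
      have := hrat (1 / 2) (by norm_num) (by norm_num) (by push_cast; exact hhalf)
      push_cast at this
      exact this
    · refine Metric.mem_closure_iff.2 fun ε hε => ?_
      -- Approximation from the right keeps `r` positive even when `x = 0`.
      obtain ⟨r, hr1, hr2⟩ := exists_rat_btwn (lt_min hlt (lt_add_of_pos_right x hε))
      have h0 := hf.translationNumber_nonneg
      obtain ⟨h3, h4⟩ := lt_min_iff.1 hr2
      refine ⟨r, hrat r (by linarith) h3.le (by linarith), ?_⟩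
      rw [dist_comm, Real.dist_eq, abs_of_pos (by linarith)]
      linarith

theorem lemma2p1 (p q : ℕ) (hp : 0 < p) (hpq : 2 * p ≤ q) (hcop : p.Coprime q) :
    (∀ π : Pattern,
      (π.IsUnimodal ∧ π.IsOverTwist ∧ π.overRotationNumber = (p : ℝ) / (q : ℝ)) ↔
        π = gammaPattern p q hp hpq hcop) ∧
    (∀ f : unitInterval → unitInterval, IsUnimodalMap f →
      ((∃ μ : ℝ, overRotationInterval f = Set.Icc μ (1 / 2) ∧ μ ≤ (p : ℝ) / (q : ℝ)) ↔
        Exhibits f (gammaPattern p q hp hpq hcop))) := by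
  have hq2 : 2 ≤ (gammaPattern p q hp hpq hcop).n := by change 2 ≤ q; omega
  have hhalf : (p : ℝ) / q ≤ 1 / 2 := by
    have h1 : (0 : ℝ) < q := by exact_mod_cast (by omega : 0 < q)
    have h2 : (2 : ℝ) * p ≤ q := by exact_mod_cast hpq
    rw [div_le_div_iff₀ h1 two_pos]
    linarith
  refine ⟨fun π => ⟨?_, ?_⟩, fun f hf => ?_⟩
  -- Uniqueness: a unimodal pattern of this number forces `γ_{p/q}`, and an over-twist forces no
  -- other pattern of its number.
  · rintro ⟨huni, ⟨hn, htwist⟩, hrot⟩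
    exact (htwist _ hq2 ((gammaPattern_overRotationNumber p q hp hpq hcop).trans hrot.symm)
      (huni.forces_gamma hn hp hpq hcop hrot)).symm
  · rintro rfl
    exact ⟨gammaPattern_isUnimodal p q hp hpq hcop, gammaPattern_isOverTwist p q hp hpq hcop,
      gammaPattern_overRotationNumber p q hp hpq hcop⟩
  · obtain ⟨c, a, hfold, hanti, htop, hbot⟩ := hf.exists_fold
    have hlow : overRotationInterval f ⊆
        Set.Ici (hfold.lift le_rfl (IsFold.level_le _ c a)).translationNumber := by
      refine closure_minimal ?_ isClosed_Ici
      rintro _ ⟨y, hy, hfy, rfl⟩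
      exact translationNumber_le_overRotationNumber hfold hanti htop hy hfy
    constructor
    · rintro ⟨μ, hμ, hle⟩
      -- Only `p/q ∈ I_f` is needed, since the rotation number of the circle map is a lower bound
      -- for `I_f`.
      refine exhibits_gamma_of_translationNumber_le hfold htop hbot hp hpq hcop (hlow ?_)
      rw [hμ]
      exact ⟨hle, hhalf⟩
    · intro hex
      obtain ⟨y, hy, hfy, hrot⟩ := hex.exists_periodicPt hq2
      rw [gammaPattern_overRotationNumber] at hrot
      have h1 := translationNumber_le_overRotationNumber hfold hanti htop hy hfy
      rw [hrot] at h1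
      exact ⟨_, overRotationInterval_eq hfold hanti htop hbot (h1.trans hhalf), h1⟩
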